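/- **Notation.** For coprime positive integers $s,r$ (or $s=1$, $r=0$) the continued fraction of the pair $(s:r)$ is the empty sequence if $r=0$, and otherwise $(c_1,c_2,\dots)$ with $c_1=\lfloor s/r\rfloor$ and $(c_2,\dots)$ the continued fraction of $(r:s-c_1r)$; in addition, for $m\ge1$, $(c_1,\dots,c_m,1)$ is admitted as another continued fraction of the pair with continued fraction $(c_1,\dots,c_m+1)$. As formal power series in $q$, let $(q)_n=\prod_{i=1}^n(1-q^i)$, $(q)_\infty=\prod_{i\ge1}(1-q^i)$, and $\left[{P\atop N}\right]=\frac{(q)_P}{(q)_N(q)_{P-N}}$ if $P\ge N\ge0$, and $0$ otherwise. A partition $n^{(k)}$ in $(f_k,n_{k,0})$ is a sequence of integers $n_{k,0}\ge n_{k,1}\ge\dots\ge n_{k,f_k}\ge0$ with parts $n_{k,1},\dots,n_{k,f_k}$, and $\mathrm{wt}(n^{(k)})=\sum_{i=1}^{f_k}n_{k,i}$; $n_{k,0}=\infty$ means no bound on the parts, and $\infty\pm a=\infty$ for finite $a$. **Statement.** Let $0<p<p'$ be coprime integers and let $(p':p)$ have continued fraction $(c_1,\dots,c_{t-1},c_t+2)$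 with $t\ge1$, $c_t\ge 0$. Let $1\le u\le t$, $1\le d\le c_u$, and let $(c_1,\dots,c_{u-1},d)$ be a continued fraction of $(s:r)$. Put $$(f_1,\dots,f_{t+1})=(c_1,\dots,c_{u-1},d,c_u-d,c_{u+1},\dots,c_t).$$ Then all exponents in the series $$B=\sum_{k=-\infty}^{\infty}\left(q^{k^2pp'+k(p'r-ps)}-q^{(kp+r)(kp'+s)}\right)$$ are non-negative, the series converges as a formal power series, and the following identities hold, the sums on the right also converging as formal power series. If $u>1$, then $$\frac{B}{(q)_\infty}=\sum q^{\,n_{u,d}+\sum_{k=1}^{u}\sum_{i=1}^{f_k}n_{k,i}^2+\sum_{k=u+1}^{x}\sum_{i=1}^{f_k}n_{k,i}(n_{k,i}-1)}\;\frac1{(q)_{2n_{1,f_1}}}\prod_{i=2}^{f_1}\frac1{(q)_{n_{1,i-1}-n_{1,i}}}\prod_{k=2}^{x}\prod_{i=1+\delta_{2,k}}^{f_k}\left[{2\left(w_k-\sum_{j=1}^in_{k,j}\right)+n_{k,i-1}+n_{k,i}\atop n_{k,i-1}-n_{k,i}}\right].$$ If $u=1$, then $$\frac{B}{(q)_\infty}=\sum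 q^{\,n_{1,d}+\sum_{i=1}^{f_1}n_{1,i}^2+\sum_{k=2}^{x}\sum_{i=1}^{f_k}n_{k,i}(n_{k,i}-1)}\;\frac1{(q)_{2(n_{2,f_2}-1)}}\prod_{i=2}^{f_1}\frac1{(q)_{n_{1,i-1}-n_{1,i}}}\prod_{i=1}^{f_2}\frac1{(q)_{n_{2,i-1}-n_{2,i}}}\prod_{k=3}^{x}\prod_{i=1+\delta_{3,k}}^{f_k}\left[{2\left(w_k-\sum_{j=1}^in_{k,j}\right)+n_{k,i-1}+n_{k,i}\atop n_{k,i-1}-n_{k,i}}\right].$$ In both cases the sum is over all $x$ with $u\le x\le t+1$ and all sequences $n^{(1)},\dots,n^{(x)}$ of partitions such that, for $1\le k\le x$, $n^{(k)}$ is in $(f_k,n_{k,0})$ and $\mathrm{wt}(n^{(k)})\le w_k$; $\mathrm{wt}(n^{(x)})=w_x$; $\mathrm{wt}(n^{(u)})<w_u$ if $u<x$; $n_{k,f_k}>0$ if $u<k<x$; and $n_{x,f_x}=0$ if $x<t+1$ (where $n_{k,f_k}$ means $n_{k,0}$ if $f_k=0$). Here $$w_1=\infty,\quad w_k=n_{k-1,f_{k-1}}\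 (2\le k\le u),\quad w_{u+1}=w_u-1-\mathrm{wt}(n^{(u)}),\quad w_k=n_{k-1,f_{k-1}}-1\ (u+2\le k\le x),$$ $$n_{1,0}=\infty,\quad n_{k,0}=w_{k-1}-\mathrm{wt}(n^{(k-1)})\ (2\le k\le u),\quad n_{u+1,0}=n_{u,f_u}+1,\quad n_{k,0}=w_{k-1}+1-\mathrm{wt}(n^{(k-1)})\ (u+2\le k\le x).$$ (If $u=1$, every sequence in the sum has $x\ge3$, so that $n_{2,f_2}\ge 1$.) -/

import Mathlib

open scoped PowerSeries PowerSeries.WithPiTopology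

noncomputable section

namespace BurgeTree

/-- The sequence `(c₁, c₂, …)` produced by the Euclidean algorithm for the pair `(s : r)`:
it is empty when `r = 0`; otherwise `c₁ = ⌊s / r⌋`, followed by the sequence of
`(r : s - c₁ r)`. -/
def euclidSeq (s r : ℕ) : List ℕ :=
  if _h : r = 0 then [] else (s / r) :: euclidSeq r (s % r)
termination_by r
decreasing_by exact Nat.mod_lt _ (Nat.pos_of_ne_zero _h)

/-- `IsContFrac l s r`: the list `l` is a continued fraction for the pair `(s : r)`, where `s` and
`r` are positive coprime integers or `s = 1`, `r = 0`. Lists `(c₁, …, c_m, 1)` with `m ≥ 1` are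
permitted, and are identified with `(c₁, …, c_m + 1)`. -/
def IsContFrac (l : List ℕ) (s r : ℕ) : Prop :=
  0 < s ∧ Nat.Coprime s r ∧
    (euclidSeq s r = l ∨
      ∃ (l' : List ℕ) (a : ℕ), l = l' ++ [a, 1] ∧ euclidSeq s r = l' ++ [a + 1])

/-- The reciprocal of a power series with constant coefficient `1`. -/
def recip (φ : ℤ⟦X⟧) : ℤ⟦X⟧ := PowerSeries.invOfUnit φ 1

/-- `(q)_n = (1 - q)(1 - q²) ⋯ (1 - qⁿ)`. -/
def qPoch (n : ℕ) : ℤ⟦X⟧ := ∏ i ∈ Finset.range n, (1 - PowerSeries.X ^ (i + 1))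

/-- `(q)_∞ = ∏_{n ≥ 1} (1 - qⁿ)`. -/
def qPochInf : ℤ⟦X⟧ := ∏' n : ℕ, (1 - PowerSeries.X ^ (n + 1))

theorem qPoch_mul_recip (n : ℕ) : qPoch n * recip (qPoch n) = 1 := by
  apply PowerSeries.mul_invOfUnit
  simp [qPoch]

theorem hasProd_qPochInf :
    HasProd (fun n : ℕ => (1 : ℤ⟦X⟧) - PowerSeries.X ^ (n + 1)) qPochInf :=
  (PowerSeries.WithPiTopology.multipliable_one_sub_X_pow ℤ).hasProd

theorem qPochInf_mul_recip : qPochInf * recip qPochInf = 1 := by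
  apply PowerSeries.mul_invOfUnit
  have h := hasProd_qPochInf.map (PowerSeries.constantCoeff (R := ℤ))
    (PowerSeries.WithPiTopology.continuous_constantCoeff ℤ)
  have h1 : (PowerSeries.constantCoeff (R := ℤ)) ∘
      (fun n : ℕ => (1 : ℤ⟦X⟧) - PowerSeries.X ^ (n + 1)) = fun _ => 1 := by
    funext n
    simp
  rw [h1] at h
  simpa using h.unique hasProd_one

/-- The Gaussian polynomial `[P; N] = (q)_P / ((q)_N (q)_{P - N})` if `P ≥ N ≥ 0`, and `0`
otherwise. -/
def gauss (P N : ℤ) : ℤ⟦X⟧ :=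
  if 0 ≤ N ∧ N ≤ P then
    qPoch P.toNat * recip (qPoch N.toNat) * recip (qPoch (P - N).toNat)
  else 0

/-- Exponent of the positive part of the bosonic series. -/
def bosExp₁ (p p' r s : ℕ) (k : ℤ) : ℤ := k ^ 2 * p * p' + k * (p' * r - p * s)

/-- Exponent of the negative part of the bosonic series. -/
def bosExp₂ (p p' r s : ℕ) (k : ℤ) : ℤ := (k * p + r) * (k * p' + s)

/-- The `k`-th term of the bosonic series. (The theorem below asserts that both exponents are
nonnegative, so that `Int.toNat` does not change them.) -/
def bosTerm (p p' r s : ℕ) (k : ℤ) : ℤ⟦X⟧ :=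
  PowerSeries.X ^ (bosExp₁ p p' r s k).toNat - PowerSeries.X ^ (bosExp₂ p p' r s k).toNat

/-- The sequence
`(f₁, …, f_{t+1}) = (c₁, …, c_{u-1}, d, c_u - d, c_{u+1}, …, c_t)` (indexed from `1`). -/
def fSeq (c : ℕ → ℕ) (u d : ℕ) (k : ℕ) : ℕ :=
  if k < u then c k else if k = u then d else if k = u + 1 then c u - d else c (k - 1)

/-- The weight of the partition `n^{(k)} = (n_{k,1}, …, n_{k,f_k})`. -/
def wt (f : ℕ → ℕ) (n : ℕ → ℕ → ℕ) (k : ℕ) : ℕ := ∑ i ∈ Finset.Icc 1 (f k), n k i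

/-- The pair `(n_{k,0}, w_k)`, for `k ≥ 1` (the value at `k = 0` is not used), with
`∞ ± a = ∞`. Here `n_{k,f_k}` means `n_{k,0}` if `f_k = 0`. -/
def bounds (u : ℕ) (f : ℕ → ℕ) (n : ℕ → ℕ → ℕ) : ℕ → ℕ∞ × ℕ∞
  | 0 => (⊤, ⊤)
  | 1 => (⊤, ⊤)
  | k + 2 =>
    let prev := bounds u f n (k + 1)
    let last : ℕ∞ := if f (k + 1) = 0 then prev.1 else (n (k + 1) (f (k + 1)) : ℕ∞)
    if k + 2 ≤ u then (prev.2 - (wt f n (k + 1) : ℕ∞), last)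
    else if k + 2 = u + 1 then (last + 1, prev.2 - 1 - (wt f n (k + 1) : ℕ∞))
    else (prev.2 + 1 - (wt f n (k + 1) : ℕ∞), last - 1)

/-- The bound `w_k` on the weight of `n^{(k)}`. -/
def wBound (u : ℕ) (f : ℕ → ℕ) (n : ℕ → ℕ → ℕ) (k : ℕ) : ℕ∞ := (bounds u f n k).2

/-- The numbers `n_{k,i}` for `0 ≤ i ≤ f_k`, including the bound `n_{k,0}` on the parts. -/
def part (u : ℕ) (f : ℕ → ℕ) (n : ℕ → ℕ → ℕ) (k i : ℕ) : ℕ∞ :=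
  if i = 0 then (bounds u f n k).1 else (n k i : ℕ∞)

/-- `(n^{(1)}, …, n^{(x)})` is one of the sequences of partitions over which the fermionic sum is
taken. The sequence is encoded by its array of parts `n k i` (`1 ≤ k ≤ x`, `1 ≤ i ≤ f k`),
extended by `0`. -/
structure IsAdmissible (t u : ℕ) (f : ℕ → ℕ) (x : ℕ) (n : ℕ → ℕ → ℕ) : Prop where
  u_le : u ≤ x
  le_t : x ≤ t + 1
  support : ∀ k i, n k i ≠ 0 → (1 ≤ k ∧ k ≤ x) ∧ (1 ≤ i ∧ i ≤ f k)
  antitone : ∀ k, 1 ≤ k → k ≤ x → ∀ i, 1 ≤ i → i ≤ f k → part u f n k i ≤ part u f n k (i - 1)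
  wt_le : ∀ k, 1 ≤ k → k ≤ x → (wt f n k : ℕ∞) ≤ wBound u f n k
  wt_last : (wt f n x : ℕ∞) = wBound u f n x
  wt_lt : u < x → (wt f n u : ℕ∞) < wBound u f n u
  pos : ∀ k, u < k → k < x → 0 < part u f n k (f k)
  last_zero : x < t + 1 → part u f n x (f x) = 0

/-- The index set of the fermionic sum. -/
def AdmissibleSeq (t u : ℕ) (f : ℕ → ℕ) : Type :=
  {σ : ℕ × (ℕ → ℕ → ℕ) // IsAdmissible t u f σ.1 σ.2}

/-- The exponent
`n_{u,d} + ∑_{k ≤ u} ∑_i n_{k,i}² + ∑_{u < k ≤ x} ∑_i n_{k,i} (n_{k,i} - 1)`. -/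
def fermExp (u d : ℕ) (f : ℕ → ℕ) (x : ℕ) (n : ℕ → ℕ → ℕ) : ℕ :=
  n u d + ∑ k ∈ Finset.Icc 1 u, ∑ i ∈ Finset.Icc 1 (f k), n k i ^ 2
    + ∑ k ∈ Finset.Icc (u + 1) x, ∑ i ∈ Finset.Icc 1 (f k), n k i * (n k i - 1)

/-- The Gaussian polynomial
`[2 (w_k - ∑_{j=1}^i n_{k,j}) + n_{k,i-1} + n_{k,i}; n_{k,i-1} - n_{k,i}]`
(used only where `w_k` and `n_{k,i-1}` are finite). -/
def fermGauss (u : ℕ) (f : ℕ → ℕ) (n : ℕ → ℕ → ℕ) (k i : ℕ) : ℤ⟦X⟧ :=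
  gauss
    (2 * (((wBound u f n k).toNat : ℤ) - ∑ j ∈ Finset.Icc 1 i, (n k j : ℤ))
      + ((part u f n k (i - 1)).toNat : ℤ) + (n k i : ℤ))
    (((part u f n k (i - 1)).toNat : ℤ) - (n k i : ℤ))

/-- `1 / (q)_{n_{k,i-1} - n_{k,i}}` (used only where `n_{k,i-1}` is finite). -/
def fermRecip (u : ℕ) (f : ℕ → ℕ) (n : ℕ → ℕ → ℕ) (k i : ℕ) : ℤ⟦X⟧ :=
  recip (qPoch ((part u f n k (i - 1)).toNat - n k i))

/-- The fermionic summand in the case `u > 1`. -/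
def fermTermGt (u d : ℕ) (f : ℕ → ℕ) (x : ℕ) (n : ℕ → ℕ → ℕ) : ℤ⟦X⟧ :=
  PowerSeries.X ^ fermExp u d f x n
    * recip (qPoch (2 * n 1 (f 1)))
    * (∏ i ∈ Finset.Icc 2 (f 1), fermRecip u f n 1 i)
    * ∏ k ∈ Finset.Icc 2 x, ∏ i ∈ Finset.Icc (1 + if k = 2 then 1 else 0) (f k),
        fermGauss u f n k i

/-- The fermionic summand in the case `u = 1`. -/
def fermTermOne (d : ℕ) (f : ℕ → ℕ) (x : ℕ) (n : ℕ → ℕ → ℕ) : ℤ⟦X⟧ :=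
  PowerSeries.X ^ fermExp 1 d f x n
    * recip (qPoch (2 * ((part 1 f n 2 (f 2)).toNat - 1)))
    * (∏ i ∈ Finset.Icc 2 (f 1), fermRecip 1 f n 1 i)
    * (∏ i ∈ Finset.Icc 1 (f 2), fermRecip 1 f n 2 i)
    * ∏ k ∈ Finset.Icc 3 x, ∏ i ∈ Finset.Icc (1 + if k = 3 then 1 else 0) (f k),
        fermGauss 1 f n k i

end BurgeTree

end

open scoped PowerSeries PowerSeries.WithPiTopology

noncomputable section

/-! The series B is deformed to a doubly bounded sum `bosPoly`: each power of q is multiplied by two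
Gaussian polynomials depending on L and M, and as L = M → ∞ the sum tends to B/(q)_∞². Two moves act
on it. The Burge transform (`bosPoly_burge`), a consequence of the q-Pfaff–Saalschütz sum
`qbin_saalschutz`, writes the polynomial for (p, p'+p, r, s+r) at (L, M) as the sum over n of q^{n²}
[2L+M-n; M-n] times the polynomial for (p, p', r, s) at (L-n, n). Exchanging L and M exchanges (p,
r) with (p', s) (`bosPoly_swap`). The Euclidean algorithm is run on (p':p) and (s:r) at once. Each
unit subtraction is a Burge transform, and its summation variable is a part n_{k,i}; L is the weight
still available to the k-th partition and M is the preceding part. Each change of roles in the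
algorithm is an exchange of L and M and starts the next partition. After d steps of the u-th
quotient, (s, r) has become (0, 1). There `bosPoly_one_zero` passes to r = s = 1 at the cost of a
factor q^M, which is q^{n_{u,d}}. From then on r = s = 1 is kept: lattice-path identities from the
Pascal rule (`bosPoly_one_one_eq_up`, `bosPoly_one_one_eq_diag`) give a Burge transform with weights
q^{n(n+1)} (`bosPoly_one_one_burge`), and shifting M by one (`bosShift`) turns these into
q^{n(n-1)}. The algorithm stops at (p, p') = (1, 2), where the value is 1 if L = 0 and 0 otherwise
(`bosShift_one_two`); the boundary values at the ends of earlier rows k ≥ u account for the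
sequences with x < t+1. The identity starts at L = M = ∞, so the moves are extended to infinite
bounds by X-adic dominated convergence (`IsBurgeStep.hasSum`). The recursion is unfolded over
prefixes of sequences of partitions: lengthening the prefixes by one part preserves the total, and
at the end of a row the complete sequences split off (`IsBurgeChain.hasSum`).
`isBurgeChain_bosChain` supplies the polynomials, and `prefixWeight_eq_fermTermGt` and
`prefixWeight_eq_fermTermOne` identify the weights with the stated summands. -/

namespace BurgeTree

/-! ### Gaussian polynomials: Pascal, q-Vandermonde and q-Pfaff–Saalschütz -/

section

open PowerSeries in
theorem qPoch_succ (n : ℕ) : qPoch (n + 1) = qPoch n * (1 - X ^ (n + 1)) := by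
  simp [qPoch, Finset.prod_range_succ]

theorem qPoch_zero : qPoch 0 = 1 := by simp [qPoch]

theorem recip_qPoch_mul (n : ℕ) : recip (qPoch n) * qPoch n = 1 := by
  rw [mul_comm, qPoch_mul_recip]

theorem recip_qPoch_zero : recip (qPoch 0) = 1 := by
  simpa [qPoch_zero] using recip_qPoch_mul 0

open PowerSeries in
theorem recip_qPoch_eq_succ (n : ℕ) :
    recip (qPoch n) = recip (qPoch (n + 1)) * (1 - X ^ (n + 1)) := by
  have h := recip_qPoch_mul n
  have h' := qPoch_mul_recip (n + 1)
  rw [qPoch_succ] at h' ⊢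
  linear_combination (-recip (qPoch n)) * h' +
    recip (qPoch n * (1 - X ^ (n + 1))) * (1 - X ^ (n + 1)) * h

/-- The Gaussian polynomial `[a + b; a]` in terms of its two lower parts. -/
def gaussN (a b : ℕ) : ℤ⟦X⟧ := qPoch (a + b) * recip (qPoch a) * recip (qPoch b)

theorem gaussN_comm (a b : ℕ) : gaussN a b = gaussN b a := by
  unfold gaussN
  rw [add_comm a b]
  ring

theorem gaussN_zero_left (b : ℕ) : gaussN 0 b = 1 := by
  simp [gaussN, recip_qPoch_zero, qPoch_mul_recip]

theorem gaussN_zero_right (a : ℕ) : gaussN a 0 = 1 := by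
  rw [gaussN_comm, gaussN_zero_left]

open PowerSeries in
theorem gaussN_succ_succ (a b : ℕ) :
    gaussN (a + 1) (b + 1) = gaussN a (b + 1) + X ^ (a + 1) * gaussN (a + 1) b := by
  unfold gaussN
  rw [recip_qPoch_eq_succ a, recip_qPoch_eq_succ b,
    show a + 1 + (b + 1) = (a + b + 1) + 1 by ring, show a + 1 + b = a + b + 1 by ring,
    show a + (b + 1) = a + b + 1 by ring, qPoch_succ (a + b + 1)]
  ring

/-- The Gaussian polynomial `[n; k]`, vanishing for `k > n`. -/
def qbin (n k : ℕ) : ℤ⟦X⟧ := if k ≤ n then gaussN (n - k) k else 0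

theorem qbin_add (a b : ℕ) : qbin (a + b) b = gaussN a b := by simp [qbin]

theorem qbin_of_lt {n k : ℕ} (h : n < k) : qbin n k = 0 := by simp [qbin, h]

theorem qbin_zero_right (n : ℕ) : qbin n 0 = 1 := by
  simp [qbin, gaussN_zero_right]

theorem qbin_symm {n k : ℕ} (h : k ≤ n) : qbin n (n - k) = qbin n k := by
  simp [qbin, h, gaussN_comm (n - k) k, Nat.sub_sub_self h]

open PowerSeries in
theorem qbin_succ_succ (n k : ℕ) :
    qbin (n + 1) (k + 1) = qbin n (k + 1) + X ^ (n - k) * qbin n k := by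
  rcases lt_trichotomy k n with h | rfl | h
  · obtain ⟨m, rfl⟩ := Nat.exists_eq_add_of_lt h
    rw [show k + m + 1 + 1 = (m + 1) + (k + 1) by ring, qbin_add,
      show k + m + 1 = m + (k + 1) by ring, qbin_add,
      show m + (k + 1) = (m + 1) + k by ring, qbin_add, gaussN_succ_succ,
      show m + 1 + k - k = m + 1 by omega]
  · rw [qbin_of_lt (Nat.lt_succ_self k)]
    simp [qbin, gaussN_zero_left]
  · rw [qbin_of_lt (by omega), qbin_of_lt (by omega), qbin_of_lt h]
    simp

/-- Both sides are the same q-trinomial coefficient; this is what regroups the triple sum in the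
Saalschütz proof. -/
theorem qbin_mul_qbin {a b c : ℕ} (h : c ≤ b) :
    qbin a b * qbin b c = qbin a c * qbin (a - c) (b - c) := by
  rcases lt_or_ge a b with hab | hab
  · rw [qbin_of_lt hab]
    rcases lt_or_ge a c with hac | hac
    · rw [qbin_of_lt hac]; simp
    · rw [qbin_of_lt (show a - c < b - c by omega)]; simp
  · obtain ⟨m, rfl⟩ := Nat.exists_eq_add_of_le' hab
    obtain ⟨l, rfl⟩ := Nat.exists_eq_add_of_le' h
    rw [qbin_add, qbin_add, show m + (l + c) - c = m + l by omega, Nat.add_sub_cancel,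
      qbin_add, show m + (l + c) = (m + l) + c by ring, qbin_add]
    unfold gaussN
    have h1 := qPoch_mul_recip (l + c)
    have h2 := qPoch_mul_recip (m + l)
    rw [show m + (l + c) = m + l + c by ring]
    linear_combination (qPoch (m + l + c) * recip (qPoch m) * recip (qPoch l) *
      recip (qPoch c)) * (h1 - h2)

open PowerSeries in
/-- The `q`-Vandermonde sum. -/
theorem qbin_vandermonde (m n k : ℕ) :
    ∑ x ∈ Finset.HasAntidiagonal.antidiagonal k, X ^ (x.1 * (n - x.2)) * (qbin m x.1 * qbin n x.2) =
      qbin (m + n) k := by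
  induction m generalizing k with
  | zero =>
    rw [Finset.sum_eq_single (0, k)]
    · simp [qbin_zero_right]
    · rintro ⟨i, j⟩ hij hne
      have : 0 < i := by
        rcases Nat.eq_zero_or_pos i with rfl | h
        · simp at hij; simp [hij] at hne
        · exact h
      simp [qbin_of_lt this]
    · simp
  | succ m ih =>
    cases k with
    | zero => simp [qbin_zero_right]
    | succ k =>
      rw [show m + 1 + n = (m + n) + 1 by ring, qbin_succ_succ, ← ih (k + 1), ← ih k,
        Finset.Nat.sum_antidiagonal_succ, Finset.Nat.sum_antidiagonal_succ, Finset.mul_sum,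
        add_assoc, ← Finset.sum_add_distrib]
      congr 1
      · simp [qbin_zero_right]
      · refine Finset.sum_congr rfl fun x hx => ?_
        rw [Finset.HasAntidiagonal.mem_antidiagonal] at hx
        rcases lt_or_ge n x.2 with h2 | h2
        · simp [qbin_of_lt h2]
        rw [qbin_succ_succ]
        rcases lt_or_ge m x.1 with h1 | h1
        · simp [qbin_of_lt h1, qbin_of_lt (show m < x.1 + 1 by omega)]
        obtain ⟨y, hy⟩ := Nat.exists_eq_add_of_le' h2
        obtain ⟨z, hz⟩ := Nat.exists_eq_add_of_le' h1
        have e1 : n - x.2 = y := by omega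
        have e2 : m - x.1 = z := by omega
        have e3 : m + n - k = y + z := by omega
        simp only [e1, e2, e3]
        ring

-- This is q-Vandermonde read backwards: the first lower index is reflected to j - i by the symmetry
-- of [j; i], and the terms whose index exceeds j vanish.
open PowerSeries in
theorem qbin_vandermonde_shift (j Y δ : ℕ) :
    ∑ x ∈ Finset.HasAntidiagonal.antidiagonal j, X ^ (x.1 * (x.1 + δ) + x.2 * (Y + j)) *
        (qbin j x.1 * qbin Y (x.1 + δ)) = X ^ (j * (j + δ)) * qbin (Y + j) (j + δ) := by
  have h := qbin_vandermonde j Y (j + δ)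
  rw [add_comm Y j, ← h, Finset.mul_sum]
  symm
  rw [Finset.Nat.sum_antidiagonal_eq_sum_range_succ_mk,
    Finset.Nat.sum_antidiagonal_eq_sum_range_succ_mk]
  have : ∀ l ∈ Finset.range (j + δ).succ, l ∉ Finset.range (j + 1) →
      (X : ℤ⟦X⟧) ^ (j * (j + δ)) *
        (X ^ (l * (Y - (j + δ - l))) * (qbin j l * qbin Y (j + δ - l))) = 0 := by
    intro l _ hl
    rw [Finset.mem_range] at hl
    simp [qbin_of_lt (show j < l by omega)]
  rw [← Finset.sum_subset (fun l hl => by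
    rw [Finset.mem_range] at *; omega) this, ← Finset.sum_range_reflect]
  refine Finset.sum_congr rfl fun i hi => ?_
  rw [Finset.mem_range] at hi
  have hi' : i ≤ j := by omega
  rw [show j + 1 - 1 - i = j - i by omega, qbin_symm hi',
    show j + δ - (j - i) = i + δ by omega]
  rcases lt_or_ge Y (i + δ) with h2 | h2
  · simp [qbin_of_lt h2]
  obtain ⟨y, rfl⟩ := Nat.exists_eq_add_of_le' h2
  obtain ⟨z, rfl⟩ := Nat.exists_eq_add_of_le' hi'
  rw [show y + (i + δ) - (i + δ) = y by omega, show z + i - i = z by omega,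
    ← mul_assoc, ← pow_add]
  congr 2
  ring

theorem sum_antidiagonal_assoc {R : Type*} [AddCommMonoid R] (M : ℕ) (f : ℕ → ℕ → ℕ → R) :
    ∑ x ∈ Finset.HasAntidiagonal.antidiagonal M,
        ∑ y ∈ Finset.HasAntidiagonal.antidiagonal x.2, f x.1 y.1 y.2 =
      ∑ x ∈ Finset.HasAntidiagonal.antidiagonal M,
        ∑ y ∈ Finset.HasAntidiagonal.antidiagonal x.1, f y.1 y.2 x.2 := by
  rw [Finset.sum_sigma', Finset.sum_sigma']
  refine Finset.sum_nbij' (fun z => ⟨(z.1.1 + z.2.1, z.2.2), (z.1.1, z.2.1)⟩)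
    (fun z => ⟨(z.2.1, z.2.2 + z.1.2), (z.2.2, z.1.2)⟩) ?_ ?_ ?_ ?_ ?_
  · rintro ⟨⟨a, b⟩, ⟨a', b'⟩⟩ h
    simp only [Finset.mem_sigma, Finset.HasAntidiagonal.mem_antidiagonal] at h ⊢
    obtain ⟨h1, h2⟩ := h
    refine ⟨?_, trivial⟩
    omega
  · rintro ⟨⟨a, b⟩, ⟨a', b'⟩⟩ h
    simp only [Finset.mem_sigma, Finset.HasAntidiagonal.mem_antidiagonal] at h ⊢
    obtain ⟨h1, h2⟩ := h
    refine ⟨?_, trivial⟩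
    omega
  · rintro ⟨⟨a, b⟩, ⟨a', b'⟩⟩ h
    simp only [Finset.mem_sigma, Finset.HasAntidiagonal.mem_antidiagonal] at h ⊢
    obtain ⟨-, rfl⟩ := h
    rfl
  · rintro ⟨⟨a, b⟩, ⟨a', b'⟩⟩ h
    simp only [Finset.mem_sigma, Finset.HasAntidiagonal.mem_antidiagonal] at h ⊢
    obtain ⟨-, rfl⟩ := h
    rfl
  · intros; rfl

open PowerSeries in
/-- The `q`-Pfaff–Saalschütz sum. -/
theorem qbin_saalschutz (A Y M δ : ℕ) :
    ∑ x ∈ Finset.HasAntidiagonal.antidiagonal M, X ^ (x.1 * (x.1 + δ)) *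
        (qbin (A + Y + x.2) x.2 * (qbin A x.1 * qbin Y (x.1 + δ))) =
      qbin (A + M + δ) M * qbin (Y + M) (M + δ) := by
  have hL : ∀ x ∈ Finset.HasAntidiagonal.antidiagonal M, (X : ℤ⟦X⟧) ^ (x.1 * (x.1 + δ)) *
        (qbin (A + Y + x.2) x.2 * (qbin A x.1 * qbin Y (x.1 + δ))) =
      ∑ y ∈ Finset.HasAntidiagonal.antidiagonal x.2, X ^ (x.1 * (x.1 + δ) + y.1 * (Y + (x.1 + y.1))) *
        (qbin A (x.1 + y.1) * qbin (x.1 + y.1) x.1 * qbin Y (x.1 + δ) * qbin (Y + M) y.2) := by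
    rintro ⟨i, b⟩ hx
    rw [Finset.HasAntidiagonal.mem_antidiagonal] at hx
    simp only at hx ⊢
    rcases lt_or_ge A i with h | h
    · rw [qbin_of_lt h, Finset.sum_eq_zero]
      · simp
      · intro y _
        rw [qbin_of_lt (show A < i + y.1 by omega)]; simp
    -- As i + b = M, the top entry can be split with A - i as one part, and [A; i][A-i; l] then
    -- becomes [A; i+l][i+l; i].
    · rw [show A + Y + b = (A - i) + (Y + M) by omega, ← qbin_vandermonde, Finset.sum_mul,
        Finset.mul_sum]
      refine Finset.sum_congr rfl fun y hy => ?_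
      rw [Finset.HasAntidiagonal.mem_antidiagonal] at hy
      rw [show Y + M - y.2 = Y + (i + y.1) by omega,
        qbin_mul_qbin (show i ≤ i + y.1 by omega), Nat.add_sub_cancel_left, pow_add]
      ring
  rw [Finset.sum_congr rfl hL]
  -- With i + l fixed, the inner sum is the shifted Vandermonde sum; the remaining outer sum is
  -- Vandermonde for A + (M + δ).
  have hassoc := sum_antidiagonal_assoc M fun i l j =>
    (X : ℤ⟦X⟧) ^ (i * (i + δ) + l * (Y + (i + l))) *
        (qbin A (i + l) * qbin (i + l) i * qbin Y (i + δ) * qbin (Y + M) j)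
  rw [hassoc, show A + M + δ = A + (M + δ) by ring, ← qbin_vandermonde, Finset.sum_mul]
  refine Finset.sum_congr rfl fun x hx => ?_
  rw [Finset.HasAntidiagonal.mem_antidiagonal] at hx
  have e := qbin_mul_qbin (a := Y + M) (b := M + δ) (c := x.2) (by omega)
  rw [show Y + M - x.2 = Y + x.1 by omega, show M + δ - x.2 = x.1 + δ by omega] at e
  rw [show M + δ - x.2 = x.1 + δ by omega]
  calc _ = ∑ y ∈ Finset.HasAntidiagonal.antidiagonal x.1, (qbin A x.1 * qbin (Y + M) x.2) *
        (X ^ (y.1 * (y.1 + δ) + y.2 * (Y + x.1)) * (qbin x.1 y.1 * qbin Y (y.1 + δ))) := by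
        refine Finset.sum_congr rfl fun y hy => ?_
        rw [Finset.HasAntidiagonal.mem_antidiagonal] at hy
        rw [hy]
        ring
    _ = _ := by
        rw [← Finset.mul_sum, qbin_vandermonde_shift]
        linear_combination (-(X : ℤ⟦X⟧) ^ (x.1 * (x.1 + δ)) * qbin A x.1) * e

end

/-! ### Convergence in the X-adic topology -/

section

open Filter Topology

-- The coefficients are discrete, so convergence means eventual agreement modulo every power of X;
-- the later limits can therefore be checked as congruences.
open PowerSeries in
theorem tendsto_iff_eventually_dvd {α : Type*} {l : Filter α} {f : α → ℤ⟦X⟧} {y : ℤ⟦X⟧} :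
    Tendsto f l (𝓝 y) ↔ ∀ N : ℕ, ∀ᶠ a in l, X ^ N ∣ f a - y := by
  rw [PowerSeries.WithPiTopology.tendsto_iff_coeff_tendsto]
  simp only [nhds_discrete, tendsto_pure, X_pow_dvd_iff, map_sub, sub_eq_zero]
  constructor
  · intro h N
    have := (Filter.eventually_all_finset (Finset.range N)).2 fun m _ => h m
    filter_upwards [this] with a ha m hm using ha m (Finset.mem_range.2 hm)
  · intro h d
    filter_upwards [h (d + 1)] with a ha using ha d (Nat.lt_succ_self d)

open PowerSeries in
theorem summable_of_finite_not_dvd {ι : Type*} {f : ι → ℤ⟦X⟧}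
    (h : ∀ N : ℕ, {i | ¬ X ^ N ∣ f i}.Finite) : Summable f := by
  rw [PowerSeries.WithPiTopology.summable_iff_summable_coeff]
  intro d
  refine summable_of_hasFiniteSupport ((h (d + 1)).subset fun i hi => ?_)
  simp only [Function.mem_support, Set.mem_ofPred_eq] at hi ⊢
  exact fun hd => hi (X_pow_dvd_iff.1 hd d (Nat.lt_succ_self d))

open PowerSeries in
theorem dvd_tsum_sub_sum {ι : Type*} {f : ι → ℤ⟦X⟧} (hf : Summable f) {N : ℕ} {s : Finset ι}
    (hs : ∀ i ∉ s, X ^ N ∣ f i) : X ^ N ∣ ∑' i, f i - ∑ i ∈ s, f i := by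
  rw [X_pow_dvd_iff]
  intro m hm
  have h := hf.map_tsum (PowerSeries.coeff (R := ℤ) m)
    (PowerSeries.WithPiTopology.continuous_coeff ℤ m)
  rw [map_sub, h, tsum_eq_sum (s := s), map_sum, sub_self]
  intro i hi
  exact X_pow_dvd_iff.1 (hs i hi) m hm

open PowerSeries in
/-- Dominated convergence for series of power series. -/
theorem tendsto_tsum_of_dvd {α ι : Type*} {l : Filter α} [l.NeBot] {F : α → ι → ℤ⟦X⟧}
    {f : ι → ℤ⟦X⟧} (hF : ∀ N : ℕ, ∃ s : Finset ι, ∀ a, ∀ i ∉ s, X ^ N ∣ F a i)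
    (h : ∀ i, Tendsto (fun a => F a i) l (𝓝 (f i))) :
    Summable f ∧ Tendsto (fun a => ∑' i, F a i) l (𝓝 (∑' i, f i)) := by
  have hf : ∀ N : ℕ, ∃ s : Finset ι, (∀ a, ∀ i ∉ s, X ^ N ∣ F a i) ∧ ∀ i ∉ s, X ^ N ∣ f i := by
    intro N
    obtain ⟨s, hs⟩ := hF N
    refine ⟨s, hs, fun i hi => ?_⟩
    obtain ⟨a, ha⟩ := (tendsto_iff_eventually_dvd.1 (h i) N).exists
    exact (dvd_sub_right (hs a i hi)).1 ha
  have key : ∀ g : ι → ℤ⟦X⟧, (∀ N : ℕ, ∃ s : Finset ι, ∀ i ∉ s, X ^ N ∣ g i) → Summable g := by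
    intro g hg
    refine summable_of_finite_not_dvd fun N => ?_
    obtain ⟨s, hs⟩ := hg N
    exact s.finite_toSet.subset fun i hi => by_contra fun hn => hi (hs i hn)
  have hfs : Summable f := key f fun N => by
    obtain ⟨s, -, hs⟩ := hf N
    exact ⟨s, hs⟩
  refine ⟨hfs, tendsto_iff_eventually_dvd.2 fun N => ?_⟩
  obtain ⟨s, hs, hs'⟩ := hf N
  have hsum := tendsto_iff_eventually_dvd.1
    (tendsto_finsetSum s fun i _ => h i) N
  filter_upwards [hsum] with a ha
  have hFa : Summable (F a) := key _ fun N => by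
    obtain ⟨s, hs⟩ := hF N
    exact ⟨s, hs a⟩
  have h1 := dvd_tsum_sub_sum hFa (hs a)
  have h2 := dvd_tsum_sub_sum hfs hs'
  have := (h1.add ha).sub h2
  convert this using 1
  ring

/-- Iterated sums alone do not give unconditional summability, so it is a separate hypothesis; the
value then follows by summing fibre by fibre. -/
theorem hasSum_of_hasSum_fiber {α β : Type*} (π : α → β) {f : α → ℤ⟦X⟧} {g : β → ℤ⟦X⟧}
    {S : ℤ⟦X⟧} (hf : Summable f) (hg : HasSum g S)
    (hfib : ∀ b, HasSum (fun a : {a // π a = b} => f a) (g b)) : HasSum f S := by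
  have h1 : HasSum (f ∘ Equiv.sigmaFiberEquiv π) (∑' a, f a) :=
    (Equiv.hasSum_iff (Equiv.sigmaFiberEquiv π)).2 hf.hasSum
  have h2 : HasSum g (∑' a, f a) := h1.sigma hfib
  rw [hg.unique h2]
  exact hf.hasSum

theorem tendsto_qPoch : Tendsto qPoch atTop (𝓝 qPochInf) := by
  have := hasProd_qPochInf.tendsto_prod_nat
  exact this

open PowerSeries in
theorem tendsto_recip_qPoch : Tendsto (fun n => recip (qPoch n)) atTop (𝓝 (recip qPochInf)) := by
  rw [tendsto_iff_eventually_dvd]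
  intro N
  filter_upwards [tendsto_iff_eventually_dvd.1 tendsto_qPoch N] with n hn
  have h1 := qPoch_mul_recip n
  have h2 := qPochInf_mul_recip
  have : recip (qPoch n) - recip qPochInf =
      -(qPoch n - qPochInf) * (recip (qPoch n) * recip qPochInf) := by
    linear_combination (recip qPochInf) * h1 - recip (qPoch n) * h2
  rw [this]
  exact (hn.neg_right).mul_right _

end

/-! ### Gaussian polynomials with integer indices -/

section

/-- The power `q ^ a` for an integer `a` that is meant to be nonnegative. -/
def qpow (a : ℤ) : ℤ⟦X⟧ := PowerSeries.X ^ a.toNat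

theorem qpow_natCast (n : ℕ) : qpow n = PowerSeries.X ^ n := by simp [qpow]

theorem qpow_zero : qpow 0 = 1 := by simp [qpow]

theorem qpow_add {a b : ℤ} (ha : 0 ≤ a) (hb : 0 ≤ b) : qpow (a + b) = qpow a * qpow b := by
  rw [qpow, Int.toNat_add ha hb, pow_add]
  rfl

/-- The Gaussian polynomial `[a + b; a]`, vanishing if `a < 0` or `b < 0`. -/
def gaussZ (a b : ℤ) : ℤ⟦X⟧ := if 0 ≤ a ∧ 0 ≤ b then gaussN a.toNat b.toNat else 0

theorem gaussZ_natCast (a b : ℕ) : gaussZ a b = gaussN a b := by simp [gaussZ]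

theorem gaussZ_comm (a b : ℤ) : gaussZ a b = gaussZ b a := by
  unfold gaussZ
  simp only [gaussN_comm a.toNat, and_comm]

theorem gaussZ_of_neg_left {a : ℤ} (b : ℤ) (h : a < 0) : gaussZ a b = 0 := by
  simp [gaussZ, h.not_ge]

theorem gaussZ_of_neg_right (a : ℤ) {b : ℤ} (h : b < 0) : gaussZ a b = 0 := by
  simp [gaussZ, h.not_ge]

theorem gaussZ_zero_left {b : ℤ} (h : 0 ≤ b) : gaussZ 0 b = 1 := by
  simp [gaussZ, h, gaussN_zero_left]

theorem gaussZ_zero_right {a : ℤ} (h : 0 ≤ a) : gaussZ a 0 = 1 := by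
  rw [gaussZ_comm, gaussZ_zero_left h]

/-- The rule fails only at (0, 0), where the left side is 1 and the right side 0. For negative a the
truncated power `qpow a` is harmless, since its cofactor vanishes. -/
theorem gaussZ_pascal {a b : ℤ} (h : ¬(a = 0 ∧ b = 0)) :
    gaussZ a b = gaussZ (a - 1) b + qpow a * gaussZ a (b - 1) := by
  rcases lt_or_ge a 0 with ha | ha
  · simp [gaussZ_of_neg_left _ ha, gaussZ_of_neg_left _ (show a - 1 < 0 by omega)]
  rcases lt_or_ge b 0 with hb | hb
  · simp [gaussZ_of_neg_right _ hb, gaussZ_of_neg_right _ (show b - 1 < 0 by omega)]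
  obtain ⟨m, rfl⟩ := Int.eq_ofNat_of_zero_le ha
  obtain ⟨n, rfl⟩ := Int.eq_ofNat_of_zero_le hb
  cases m with
  | zero =>
    cases n with
    | zero => simp at h
    | succ n =>
      rw [Nat.cast_zero, gaussZ_zero_left (by omega), gaussZ_of_neg_left _ (by omega),
        gaussZ_zero_left (by omega), qpow_zero]
      simp
  | succ m =>
    cases n with
    | zero =>
      rw [Nat.cast_zero, gaussZ_zero_right (by omega), gaussZ_zero_right (by omega),
        gaussZ_of_neg_right _ (by omega)]
      simp
    | succ n =>
      rw [show ((m + 1 : ℕ) : ℤ) - 1 = (m : ℕ) by simp,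
        show ((n + 1 : ℕ) : ℤ) - 1 = (n : ℕ) by simp]
      simp only [gaussZ_natCast, qpow_natCast, gaussN_succ_succ]

theorem gaussZ_pascal' {a b : ℤ} (h : ¬(a = 0 ∧ b = 0)) :
    gaussZ a b = gaussZ a (b - 1) + qpow b * gaussZ (a - 1) b := by
  rw [gaussZ_comm, gaussZ_pascal (fun h' => h ⟨h'.2, h'.1⟩), gaussZ_comm (b - 1),
    gaussZ_comm b]

theorem gauss_eq_gaussZ (P N : ℤ) : gauss P N = gaussZ (P - N) N := by
  unfold gauss gaussZ
  by_cases h : 0 ≤ N ∧ N ≤ P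
  · rw [if_pos h, if_pos (by omega), gaussN, ← Int.toNat_add (by omega) h.1, sub_add_cancel]
    ring
  · rw [if_neg h, if_neg (by omega)]

theorem qbin_eq_gaussZ (n k : ℕ) : qbin n k = gaussZ (n - k) k := by
  unfold qbin gaussZ
  by_cases h : k ≤ n
  · rw [if_pos h, if_pos (by omega)]
    congr 1
    omega
  · rw [if_neg h, if_neg (by omega)]

theorem gaussZ_saalschutz_nat (x y M δ : ℕ) :
    ∑ i ∈ Finset.range (M + 1), qpow (i * (i + δ)) * gaussZ (x + y) (M - i) *
        (gaussZ (x - i) i * gaussZ (y - (i + δ)) (i + δ)) =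
      gaussZ (x + δ) M * gaussZ (y - δ) (M + δ) := by
  have h := qbin_saalschutz x y M δ
  rw [Finset.Nat.sum_antidiagonal_eq_sum_range_succ_mk] at h
  simp only [qbin_eq_gaussZ] at h
  convert h using 1
  · refine Finset.sum_congr rfl fun i hi => ?_
    have hi' : i ≤ M := by simpa [Nat.lt_succ_iff] using hi
    rw [mul_assoc]
    congr 1
    push_cast [Nat.cast_sub hi']
    congr 2
    ring
  · congr 2
    · push_cast; ring
    · push_cast; ring

/-- The terms with n < b vanish; putting n = b + i and δ = 2b + ε reduces the rest to the sum over
natural indices. -/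
theorem gaussZ_saalschutz_of_nonneg (L M : ℕ) {x y b ε : ℤ} (hx : 0 ≤ x) (hy : 0 ≤ y)
    (hxy : x + y = 2 * L) (hb : 0 ≤ b) (hε : 0 ≤ 2 * b + ε) :
    ∑ n ∈ Finset.range (M + 1), qpow ((n - b) * (n + b + ε)) * gaussZ (2 * L) (M - n) *
        (gaussZ (x - (n - b)) (n - b) * gaussZ (y - (n + b + ε)) (n + b + ε)) =
      gaussZ (x + 2 * b + ε) (M - b) * gaussZ (y - 2 * b - ε) (M + b + ε) := by
  rcases lt_or_ge (M : ℤ) b with hM | hM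
  · rw [gaussZ_of_neg_right _ (show (M : ℤ) - b < 0 by omega), zero_mul, Finset.sum_eq_zero]
    intro n hn
    rw [Finset.mem_range] at hn
    rw [gaussZ_of_neg_right _ (show (n : ℤ) - b < 0 by omega)]
    simp
  · obtain ⟨b, rfl⟩ := Int.eq_ofNat_of_zero_le hb
    obtain ⟨x, rfl⟩ := Int.eq_ofNat_of_zero_le hx
    obtain ⟨y, rfl⟩ := Int.eq_ofNat_of_zero_le hy
    obtain ⟨m, rfl⟩ := Nat.exists_eq_add_of_le (show b ≤ M by omega)
    obtain ⟨δ, hδ⟩ := Int.eq_ofNat_of_zero_le hε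
    have hε : ε = δ - 2 * b := by omega
    subst hε
    rw [add_assoc, Finset.sum_range_add, Finset.sum_eq_zero, zero_add]
    · have h := gaussZ_saalschutz_nat x y m δ
      convert h using 1
      · refine Finset.sum_congr rfl fun i _ => ?_
        push_cast
        congr 1
        · congr 2 <;> [skip; skip; ring]
          · ring
          · omega
        · congr 2 <;> ring
      · push_cast
        congr 2 <;> ring
    · intro n hn
      rw [Finset.mem_range] at hn
      rw [gaussZ_of_neg_right _ (show (n : ℤ) - b < 0 by omega)]
      simp

/-- The `q`-Pfaff–Saalschütz sum in a form symmetric under the exchange of the two factors. -/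
theorem gaussZ_saalschutz (L M : ℕ) {x y b ε : ℤ} (hx : 0 ≤ x) (hy : 0 ≤ y)
    (hxy : x + y = 2 * L) (hε : ε = 0 ∨ ε = 1) :
    ∑ n ∈ Finset.range (M + 1), qpow ((n - b) * (n + b + ε)) * gaussZ (2 * L) (M - n) *
        (gaussZ (x - (n - b)) (n - b) * gaussZ (y - (n + b + ε)) (n + b + ε)) =
      gaussZ (x + 2 * b + ε) (M - b) * gaussZ (y - 2 * b - ε) (M + b + ε) := by
  rcases le_or_gt 0 b with hb | hb
  · exact gaussZ_saalschutz_of_nonneg L M hx hy hxy hb (by omega)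
  -- The substitution b ↦ -b - ε exchanges n - b with n + b + ε, hence x with y, and makes b
  -- nonnegative.
  · have h := gaussZ_saalschutz_of_nonneg L M (b := -b - ε) (ε := ε) hy hx (by omega) (by omega)
      (by omega)
    have e1 : ∀ n : ℤ, n - (-b - ε) = n + b + ε := fun n => by ring
    have e2 : ∀ n : ℤ, n + (-b - ε) + ε = n - b := fun n => by ring
    simp only [e1, e2] at h
    rw [show y + 2 * (-b - ε) + ε = y - 2 * b - ε by ring,
      show x - 2 * (-b - ε) - ε = x + 2 * b + ε by ring] at h
    rw [mul_comm (gaussZ (x + 2 * b + ε) _), ← h]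
    refine Finset.sum_congr rfl fun n _ => ?_
    rw [mul_comm ((n : ℤ) - b)]
    ring

end

/-! ### Bosonic sums and the Burge transform -/

section

open Filter Topology

/-- The parameter range in which the bosonic exponents are nonnegative. -/
structure BosRange (p p' r s : ℤ) : Prop where
  one_le_left : 1 ≤ p
  one_le_right : 1 ≤ p'
  r_nonneg : 0 ≤ r
  r_le : r ≤ p
  s_nonneg : 0 ≤ s
  s_le : s ≤ p'

theorem BosRange.swap {p p' r s : ℤ} (h : BosRange p p' r s) : BosRange p' p s r :=
  ⟨h.2, h.1, h.5, h.6, h.3, h.4⟩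

/-- Exponent of the positive part of the bosonic series, for integer parameters. -/
def bosExpPos (p p' r s k : ℤ) : ℤ := k ^ 2 * p * p' + k * (p' * r - p * s)

/-- Exponent of the negative part of the bosonic series, for integer parameters. -/
def bosExpNeg (p p' r s k : ℤ) : ℤ := (k * p + r) * (k * p' + s)

/-- On the parameter range the exponent is at least |k|(|k|-1)pp'. This linear lower bound yields
both nonnegativity and summability over k. -/
theorem abs_sub_one_le_bosExpPos {p p' r s : ℤ} (h : BosRange p p' r s) (k : ℤ) :
    |k| - 1 ≤ bosExpPos p p' r s k := by
  obtain ⟨h1, h2, h3, h4, h5, h6⟩ := h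
  have hpp : 1 ≤ p * p' := by nlinarith
  have h7 : |k| * (|k| - 1) * (p * p') ≤ bosExpPos p p' r s k := by
    unfold bosExpPos
    rcases le_or_gt 0 k with hk | hk
    · rw [abs_of_nonneg hk]
      have a1 : 0 ≤ k * (p' * r) := by positivity
      have a2 : 0 ≤ k * (p * (p' - s)) :=
        mul_nonneg hk (mul_nonneg (by omega) (by omega))
      nlinarith
    · rw [abs_of_neg hk]
      have a1 : 0 ≤ (-k) * (p * s) := mul_nonneg (by omega) (mul_nonneg (by omega) h5)
      have a2 : 0 ≤ (-k) * (p' * (p - r)) :=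
        mul_nonneg (by omega) (mul_nonneg (by omega) (by omega))
      nlinarith
  rcases eq_or_ne k 0 with rfl | hk
  · simp [bosExpPos]
  · have hk1 : 1 ≤ |k| := Int.one_le_abs hk
    have : |k| * (|k| - 1) ≤ |k| * (|k| - 1) * (p * p') :=
      le_mul_of_one_le_right (mul_nonneg (by omega) (by omega)) hpp
    nlinarith

theorem abs_sub_one_le_bosExpNeg {p p' r s : ℤ} (h : BosRange p p' r s) (k : ℤ) :
    |k| - 1 ≤ bosExpNeg p p' r s k := by
  obtain ⟨h1, h2, h3, h4, h5, h6⟩ := h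
  unfold bosExpNeg
  rcases le_or_gt 0 k with hk | hk
  · rw [abs_of_nonneg hk]
    have a1 : k ≤ k * p + r := by nlinarith
    have a2 : k ≤ k * p' + s := by nlinarith
    nlinarith [mul_le_mul a1 a2 hk (by omega)]
  · rw [abs_of_neg hk]
    have a1 : -k - 1 ≤ -(k * p + r) := by nlinarith
    have a2 : -k - 1 ≤ -(k * p' + s) := by nlinarith
    have := mul_le_mul a1 a2 (by omega) (by omega)
    nlinarith [mul_nonneg (show 0 ≤ -k - 1 by omega) (show 0 ≤ -k - 1 by omega),
      Int.le_self_sq (-k - 1)]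

theorem bosExpPos_nonneg {p p' r s : ℤ} (h : BosRange p p' r s) (k : ℤ) :
    0 ≤ bosExpPos p p' r s k := by
  rcases eq_or_ne k 0 with rfl | hk
  · simp [bosExpPos]
  · have := abs_sub_one_le_bosExpPos h k
    have := Int.one_le_abs hk
    omega

theorem bosExpNeg_nonneg {p p' r s : ℤ} (h : BosRange p p' r s) (k : ℤ) :
    0 ≤ bosExpNeg p p' r s k := by
  rcases eq_or_ne k 0 with rfl | hk
  · simpa [bosExpNeg] using mul_nonneg h.r_nonneg h.s_nonneg
  · have := abs_sub_one_le_bosExpNeg h k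
    have := Int.one_le_abs hk
    omega

open PowerSeries in
theorem X_pow_dvd_qpow {N : ℕ} {a : ℤ} (h : (N : ℤ) ≤ a) : X ^ N ∣ qpow a :=
  pow_dvd_pow _ (by omega)

-- The finite set depends only on N, not on the exponents or coefficients; this uniformity is what
-- dominated convergence needs.
open PowerSeries in
theorem exists_finset_bos_dvd (N : ℕ) : ∃ S : Finset ℤ, ∀ (e : ℤ → ℤ) (u : ℤ → ℤ⟦X⟧),
    (∀ k, |k| - 1 ≤ e k) → ∀ k ∉ S, X ^ N ∣ qpow (e k) * u k := by
  refine ⟨Finset.Icc (-N) N, fun e u he k hk => Dvd.dvd.mul_right (X_pow_dvd_qpow ?_) _⟩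
  have := he k
  rw [Finset.mem_Icc, ← abs_le] at hk
  omega

theorem summable_qpow_mul {e : ℤ → ℤ} (he : ∀ k, |k| - 1 ≤ e k) (u : ℤ → ℤ⟦X⟧) :
    Summable fun k => qpow (e k) * u k := by
  refine summable_of_finite_not_dvd fun N => ?_
  obtain ⟨S, hS⟩ := exists_finset_bos_dvd N
  exact S.finite_toSet.subset fun k hk => by_contra fun hn => hk (hS e u he k hn)

/-- The alternating sum with the bosonic exponents and coefficients `u`, `v`. -/
def bosSum (p p' r s : ℤ) (u v : ℤ → ℤ⟦X⟧) : ℤ⟦X⟧ :=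
  ∑' k : ℤ, (qpow (bosExpPos p p' r s k) * u k - qpow (bosExpNeg p p' r s k) * v k)

section

variable {p p' r s : ℤ}

theorem summable_pos (h : BosRange p p' r s) (u : ℤ → ℤ⟦X⟧) :
    Summable fun k => qpow (bosExpPos p p' r s k) * u k :=
  summable_qpow_mul (abs_sub_one_le_bosExpPos h) u

theorem summable_neg (h : BosRange p p' r s) (v : ℤ → ℤ⟦X⟧) :
    Summable fun k => qpow (bosExpNeg p p' r s k) * v k :=
  summable_qpow_mul (abs_sub_one_le_bosExpNeg h) v

theorem bosSum_eq_sub (h : BosRange p p' r s) (u v : ℤ → ℤ⟦X⟧) :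
    bosSum p p' r s u v = ∑' k, qpow (bosExpPos p p' r s k) * u k -
      ∑' k, qpow (bosExpNeg p p' r s k) * v k :=
  (summable_pos h u).tsum_sub (summable_neg h v)

theorem bosSum_swap (h : BosRange p p' r s) (u v : ℤ → ℤ⟦X⟧) :
    bosSum p p' r s u v = bosSum p' p s r (fun k => u (-k)) v := by
  rw [bosSum_eq_sub h, bosSum_eq_sub h.swap, ← (Equiv.neg ℤ).tsum_eq]
  congr 1
  · refine tsum_congr fun k => ?_
    congr 2
    simp only [bosExpPos, Equiv.neg_apply]
    ring
  · refine tsum_congr fun k => ?_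
    congr 2
    simp only [bosExpNeg]
    ring

theorem tendsto_bosSum (h : BosRange p p' r s) {α : Type*} {l : Filter α} [l.NeBot]
    {u v : α → ℤ → ℤ⟦X⟧} {u₀ v₀ : ℤ → ℤ⟦X⟧} (hu : ∀ k, Tendsto (fun a => u a k) l (𝓝 (u₀ k)))
    (hv : ∀ k, Tendsto (fun a => v a k) l (𝓝 (v₀ k))) :
    Tendsto (fun a => bosSum p p' r s (u a) (v a)) l (𝓝 (bosSum p p' r s u₀ v₀)) := by
  refine (tendsto_tsum_of_dvd (fun N => ?_) fun k =>
    ((hu k).const_mul _).sub ((hv k).const_mul _)).2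
  obtain ⟨S, hS⟩ := exists_finset_bos_dvd N
  exact ⟨S, fun a k hk => (hS _ (u a) (abs_sub_one_le_bosExpPos h) k hk).sub
    (hS _ (v a) (abs_sub_one_le_bosExpNeg h) k hk)⟩

/-- The sum over n is finite and so commutes with the sum over k: a transform need only be verified
for each k separately. -/
theorem sum_mul_bosSum (h : BosRange p p' r s) {q q' a b : ℤ} (t : Finset ℕ)
    (w : ℕ → ℤ⟦X⟧) (u v : ℕ → ℤ → ℤ⟦X⟧) (u' v' : ℤ → ℤ⟦X⟧)
    (hu : ∀ k, ∑ n ∈ t, w n * (qpow (bosExpPos p p' r s k) * u n k) =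
      qpow (bosExpPos q q' a b k) * u' k)
    (hv : ∀ k, ∑ n ∈ t, w n * (qpow (bosExpNeg p p' r s k) * v n k) =
      qpow (bosExpNeg q q' a b k) * v' k) :
    bosSum q q' a b u' v' = ∑ n ∈ t, w n * bosSum p p' r s (u n) (v n) := by
  have hs : ∀ n, Summable fun k => qpow (bosExpPos p p' r s k) * u n k -
      qpow (bosExpNeg p p' r s k) * v n k :=
    fun n => (summable_pos h (u n)).sub (summable_neg h (v n))
  unfold bosSum
  simp_rw [← fun n => (hs n).tsum_mul_left (w n)]
  rw [← Summable.tsum_finsetSum fun n _ => (hs n).mul_left (w n)]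
  refine tsum_congr fun k => ?_
  simp only [mul_sub, Finset.sum_sub_distrib, hu, hv]

end

/-- The doubly bounded analogue of the bosonic series. -/
def bosPoly (p p' r s L M : ℤ) : ℤ⟦X⟧ :=
  bosSum p p' r s
    (fun k => gaussZ (L + k * p') (M - k * p) * gaussZ (L - k * p') (M + k * p))
    (fun k => gaussZ (L + (k * p' + s)) (M - (k * p + r)) *
      gaussZ (L - (k * p' + s)) (M + (k * p + r)))

theorem bosPoly_swap {p p' r s : ℤ} (h : BosRange p p' r s) (L M : ℤ) :
    bosPoly p p' r s L M = bosPoly p' p s r M L := by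
  unfold bosPoly
  rw [bosSum_swap h]
  congr 1
  · funext k
    rw [gaussZ_comm, gaussZ_comm (L - _)]
    congr 2 <;> ring
  · funext k
    rw [gaussZ_comm, gaussZ_comm (L - _), mul_comm]

theorem gaussZ_mul_gaussZ_eq_zero {A B C D : ℤ} (h : A < 0 ∨ B < 0 ∨ C < 0 ∨ D < 0) :
    gaussZ A B * gaussZ C D = 0 := by
  rcases h with h | h | h | h
  · rw [gaussZ_of_neg_left _ h, zero_mul]
  · rw [gaussZ_of_neg_right _ h, zero_mul]
  · rw [gaussZ_of_neg_left _ h, mul_zero]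
  · rw [gaussZ_of_neg_right _ h, mul_zero]

theorem bosSum_eq_zero {p p' r s : ℤ} {u v : ℤ → ℤ⟦X⟧} (hu : ∀ k, u k = 0) (hv : ∀ k, v k = 0) :
    bosSum p p' r s u v = 0 := by
  simp [bosSum, hu, hv]

theorem bosPoly_of_neg (p p' r s : ℤ) {L : ℤ} (M : ℤ) (hL : L < 0) :
    bosPoly p p' r s L M = 0 :=
  bosSum_eq_zero (fun k => gaussZ_mul_gaussZ_eq_zero (by omega))
    (fun k => gaussZ_mul_gaussZ_eq_zero (by omega))

/-- The summation underlying the Burge transform. -/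
theorem sum_burge (L M : ℕ) {x y b ε E : ℤ} (hE : 0 ≤ E) (hxy : x + y = 2 * L)
    (hε : ε = 0 ∨ ε = 1) (hz : 0 ≤ x ∧ 0 ≤ y ∨ x + 2 * b + ε < 0 ∨ y - 2 * b - ε < 0) :
    ∑ n ∈ Finset.range (M + 1), qpow (n * (n + ε)) * gaussZ (2 * L) (M - n) *
        (qpow E * (gaussZ (x - (n - b)) (n - b) * gaussZ (y - (n + b + ε)) (n + b + ε))) =
      qpow (E + b * (b + ε)) *
        (gaussZ (x + 2 * b + ε) (M - b) * gaussZ (y - 2 * b - ε) (M + b + ε)) := by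
  by_cases hpos : 0 ≤ x ∧ 0 ≤ y
  · rw [← gaussZ_saalschutz L M hpos.1 hpos.2 hxy hε, Finset.mul_sum]
    refine Finset.sum_congr rfl fun n _ => ?_
    by_cases hn : 0 ≤ (n : ℤ) - b ∧ 0 ≤ (n : ℤ) + b + ε
    · have hb : 0 ≤ b * (b + ε) := by rcases hε with rfl | rfl <;> nlinarith [sq_nonneg b, Int.le_self_sq (-b)]
      -- The exponents match because n(n+ε) = (n-b)(n+b+ε) + b(b+ε); nonnegativity is required since
      -- `qpow` truncates.
      have h1 : qpow (n * (n + ε)) * qpow E =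
          qpow (E + b * (b + ε)) * qpow ((n - b) * (n + b + ε)) := by
        rw [← qpow_add (by rcases hε with rfl | rfl <;> positivity) hE,
          ← qpow_add (add_nonneg hE hb) (mul_nonneg hn.1 hn.2)]
        congr 1
        ring
      linear_combination (gaussZ (2 * L) (M - n) *
        (gaussZ (x - (n - b)) (n - b) * gaussZ (y - (n + b + ε)) (n + b + ε))) * h1
    · rw [gaussZ_mul_gaussZ_eq_zero (by omega)]
      simp
  -- The two indices of each left-hand Gaussian add up to x or to y, so a negative x or y kills
  -- every term on the left; `hz` kills the right side.
  · rw [gaussZ_mul_gaussZ_eq_zero (by omega), mul_zero, Finset.sum_eq_zero]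
    intro n _
    rw [gaussZ_mul_gaussZ_eq_zero (by omega)]
    simp

/-- The Burge transform of the bosonic polynomials. -/
theorem bosPoly_burge {p p' r s : ℤ} (h : BosRange p p' r s) (L M : ℕ) :
    bosPoly p (p' + p) r (s + r) L M =
      ∑ n ∈ Finset.range (M + 1), qpow (n * (n + 0)) * gaussZ (2 * L) (M - n) *
        bosPoly p p' r s (L - n) n := by
  -- Equal signs of the two displacements ensure that whenever x or y is negative an index on the
  -- transformed side is negative too, as `sum_burge` demands.
  have hsign : ∀ k : ℤ, (0 ≤ k * p' ∧ 0 ≤ k * p) ∨ (k * p' ≤ 0 ∧ k * p ≤ 0) := by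
    intro k
    have := h.one_le_left
    have := h.one_le_right
    rcases le_total 0 k with hk | hk
    · left; constructor <;> positivity
    · right; constructor <;> exact mul_nonpos_of_nonpos_of_nonneg hk (by omega)
  have hsign' : ∀ k : ℤ, (0 ≤ k * p' + s ∧ 0 ≤ k * p + r) ∨ (k * p' + s ≤ 0 ∧ k * p + r ≤ 0) := by
    intro k
    obtain ⟨h1, h2, h3, h4, h5, h6⟩ := h
    rcases le_or_gt 0 k with hk | hk
    · left; constructor <;> positivity
    · right; constructor <;> nlinarith
  refine sum_mul_bosSum h _ _ _ _ _ _ (fun k => ?_) (fun k => ?_)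
  · have := sum_burge L M (x := L + k * p' - k * p) (y := L - k * p' + k * p) (b := k * p) (ε := 0)
      (bosExpPos_nonneg h k) (by ring) (Or.inl rfl) (by have := hsign k; omega)
    convert this using 1
    · refine Finset.sum_congr rfl fun n _ => ?_
      congr 3 <;> congr 1 <;> ring
    · congr 2
      · simp only [bosExpPos]; ring
      · congr 1; ring
      · congr 1 <;> ring
  · have := sum_burge L M (x := L + (k * p' + s) - (k * p + r))
      (y := L - (k * p' + s) + (k * p + r)) (b := k * p + r) (ε := 0)
      (bosExpNeg_nonneg h k) (by ring) (Or.inl rfl) (by have := hsign' k; omega)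
    convert this using 1
    · refine Finset.sum_congr rfl fun n _ => ?_
      congr 3 <;> congr 1 <;> ring
    · congr 2
      · simp only [bosExpNeg]; ring
      · congr 1; ring
      · congr 1 <;> ring

end

/-! ### The boundary parameters r = s = 1 and (r, s) = (1, 0) -/

section

section

variable {p p' : ℤ}

theorem bosRange_one_one (hp : 1 ≤ p) (hp' : 1 ≤ p') : BosRange p p' 1 1 :=
  ⟨hp, hp', by omega, hp, by omega, hp'⟩

theorem bosRange_one_zero (hp : 1 ≤ p) (hp' : 1 ≤ p') : BosRange p p' 1 0 :=
  ⟨hp, hp', by omega, hp, le_rfl, by omega⟩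

theorem mul_sign_cases (hp : 1 ≤ p) (hp' : 1 ≤ p') (k : ℤ) :
    (k = 0 ∧ k * p' = 0 ∧ k * p = 0) ∨ (1 ≤ k * p' ∧ 1 ≤ k * p) ∨
      (k * p' ≤ -1 ∧ k * p ≤ -1) := by
  rcases lt_trichotomy k 0 with hk | rfl | hk
  · right; right; constructor <;> nlinarith
  · simp
  · right; left; constructor <;> nlinarith

theorem tsum_sub_comp_equiv {ι : Type*} (σ : ι ≃ ι) {u : ι → ℤ⟦X⟧} (hu : Summable u) :
    ∑' i, (u i - u (σ i)) = 0 := by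
  have h := hu.tsum_sub ((Equiv.summable_iff σ).2 hu)
  rw [σ.tsum_eq (f := u) |> fun e => (show ∑' i, (u ∘ σ) i = _ from e), sub_self] at h
  exact h

/-- Lengthening the second path by a horizontal step does not change the sum. -/
theorem bosPoly_one_one_eq_right (hp : 1 ≤ p) (hp' : 1 ≤ p') {L M : ℤ} (hL : 0 ≤ L) (hM : 0 ≤ M) :
    bosPoly p p' 1 1 L M = bosSum p p' 1 1
      (fun k => gaussZ (L + k * p') (M - k * p) * gaussZ (L + 1 - k * p') (M + k * p))
      (fun k => gaussZ (L + k * p' + 1) (M - k * p - 1) *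
        gaussZ (L - k * p') (M + k * p + 1)) := by
  have h := bosRange_one_one hp hp'
  -- This is the Pascal remainder of the k-th positive term. The remainder of the k-th negative term
  -- equals the positive one at -k, so the corrections cancel after reindexing.
  let w : ℤ → ℤ⟦X⟧ := fun k => gaussZ (L + k * p') (M - k * p) *
    (qpow (L + 1 - k * p') * gaussZ (L + 1 - k * p') (M + k * p - 1))
  let U : ℤ → ℤ⟦X⟧ := fun k => qpow (bosExpPos p p' 1 1 k) * w k
  have hU : Summable U := summable_pos h w
  rw [eq_comm, ← sub_eq_zero]
  unfold bosPoly bosSum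
  rw [← Summable.tsum_sub ((summable_pos h _).sub (summable_neg h _))
    ((summable_pos h _).sub (summable_neg h _)), ← tsum_sub_comp_equiv (Equiv.neg ℤ) hU]
  refine tsum_congr fun k => ?_
  have hs := mul_sign_cases hp hp' k
  have p1 := gaussZ_pascal (a := L + 1 - k * p') (b := M + k * p) (by omega)
  have p2 := gaussZ_pascal (a := L - k * p') (b := M + k * p + 1) (by omega)
  rw [show L + 1 - k * p' - 1 = L - k * p' by ring] at p1
  rw [show M + k * p + 1 - 1 = M + k * p by ring] at p2
  simp only [U, w, Equiv.neg_apply]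
  rw [p1, p2, show L - (k * p' + 1) = L - k * p' - 1 by ring,
    show L + (k * p' + 1) = L + k * p' + 1 by ring,
    show M - (k * p + 1) = M - k * p - 1 by ring,
    show M + (k * p + 1) = M + k * p + 1 by ring,
    show L + -k * p' = L - k * p' by ring, show M - -k * p = M + k * p by ring,
    show L + 1 - -k * p' = L + k * p' + 1 by ring, show M + -k * p - 1 = M - k * p - 1 by ring]
  have key : qpow (bosExpNeg p p' 1 1 k) * qpow (L - k * p') *
      (gaussZ (L + k * p' + 1) (M - k * p - 1) * gaussZ (L - k * p') (M + k * p)) =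
      qpow (bosExpPos p p' 1 1 (-k)) * qpow (L + k * p' + 1) *
      (gaussZ (L + k * p' + 1) (M - k * p - 1) * gaussZ (L - k * p') (M + k * p)) := by
    by_cases hc : 0 ≤ L + k * p' + 1 ∧ 0 ≤ L - k * p'
    · rw [← qpow_add (bosExpNeg_nonneg h k) hc.2, ← qpow_add (bosExpPos_nonneg h (-k)) hc.1]
      congr 2
      simp only [bosExpNeg, bosExpPos]
      ring
    · rw [gaussZ_mul_gaussZ_eq_zero (by omega)]
      simp
  linear_combination -key

/-- Lengthening the second path by a vertical step does not change the sum. -/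
theorem bosPoly_one_one_eq_up (hp : 1 ≤ p) (hp' : 1 ≤ p') {L M : ℤ} (hL : 0 ≤ L) (hM : 0 ≤ M) :
    bosPoly p p' 1 1 L M = bosSum p p' 1 1
      (fun k => gaussZ (L + k * p') (M - k * p) * gaussZ (L - k * p') (M + k * p + 1))
      (fun k => gaussZ (L + k * p' + 1) (M - k * p) *
        gaussZ (L - k * p' - 1) (M + k * p + 1)) := by
  rw [bosPoly_swap (bosRange_one_one hp hp'), bosPoly_one_one_eq_right hp' hp hM hL,
    bosSum_swap (bosRange_one_one hp' hp)]
  congr 1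
  · funext k
    rw [gaussZ_comm, gaussZ_comm (M + 1 - _), mul_comm]
    rw [mul_comm]
    congr 2 <;> ring
  · funext k
    rw [gaussZ_comm, gaussZ_comm (M - _), mul_comm]

/-- Lengthening the second path by a diagonal step does not change the sum. -/
theorem bosPoly_one_one_eq_diag (hp : 1 ≤ p) (hp' : 1 ≤ p') (L : ℤ) {M : ℤ} (hM : 0 ≤ M) :
    bosPoly p p' 1 1 L M = bosSum p p' 1 1
      (fun k => gaussZ (L + k * p') (M - k * p) * gaussZ (L + 1 - k * p') (M + k * p + 1))
      (fun k => gaussZ (L + k * p' + 1) (M - k * p) * gaussZ (L - k * p') (M + k * p + 1)) := by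
  have h := bosRange_one_one hp hp'
  rcases lt_or_ge L 0 with hL | hL
  · rw [bosPoly_of_neg _ _ _ _ _ hL, bosSum_eq_zero (fun k => gaussZ_mul_gaussZ_eq_zero (by omega))
      (fun k => gaussZ_mul_gaussZ_eq_zero (by omega))]
  rw [bosPoly_one_one_eq_right hp hp' hL hM]
  unfold bosSum
  refine tsum_congr fun k => ?_
  beta_reduce
  have hs := mul_sign_cases hp hp' k
  have p1 := gaussZ_pascal' (a := L + 1 - k * p') (b := M + k * p + 1) (by omega)
  have p2 := gaussZ_pascal' (a := L + k * p' + 1) (b := M - k * p) (by omega)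
  rw [show L + 1 - k * p' - 1 = L - k * p' by ring,
    show M + k * p + 1 - 1 = M + k * p by ring] at p1
  rw [show L + k * p' + 1 - 1 = L + k * p' by ring] at p2
  rw [p1, p2]
  -- Here the Pascal remainders of the positive and negative terms cancel for the same k, without
  -- reindexing.
  have key : qpow (bosExpNeg p p' 1 1 k) * qpow (M - k * p) *
      (gaussZ (L + k * p') (M - k * p) * gaussZ (L - k * p') (M + k * p + 1)) =
      qpow (bosExpPos p p' 1 1 k) * qpow (M + k * p + 1) *
      (gaussZ (L + k * p') (M - k * p) * gaussZ (L - k * p') (M + k * p + 1)) := by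
    by_cases hc : 0 ≤ M + k * p + 1 ∧ 0 ≤ M - k * p
    · rw [← qpow_add (bosExpNeg_nonneg h k) hc.2, ← qpow_add (bosExpPos_nonneg h k) hc.1]
      congr 2
      simp only [bosExpNeg, bosExpPos]
      ring
    · rw [gaussZ_mul_gaussZ_eq_zero (by omega)]
      simp
  linear_combination key

/-- For (r, s) = (1, 0) the two bosonic exponents coincide. Applying Pascal to one factor of each
product leaves a common term that cancels; what survives is the horizontally lengthened form for r =
s = 1. The factor `qpow M` is the origin of q^{n_{u,d}}. -/
theorem bosPoly_one_zero (hp : 1 ≤ p) (hp' : 1 ≤ p') {L M : ℤ} (hL : 1 ≤ L) (hM : 0 ≤ M) :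
    bosPoly p p' 1 0 L M = qpow M * bosPoly p p' 1 1 (L - 1) M := by
  have h := bosRange_one_one hp hp'
  have h0 := bosRange_one_zero hp hp'
  rw [bosPoly_one_one_eq_right hp hp' (by omega) hM]
  unfold bosPoly bosSum
  rw [← Summable.tsum_mul_left _ ((summable_pos h _).sub (summable_neg h _))]
  refine tsum_congr fun k => ?_
  beta_reduce
  have hs := mul_sign_cases hp hp' k
  have p1 := gaussZ_pascal' (a := L + k * p') (b := M - k * p) (by omega)
  have p2 := gaussZ_pascal' (a := L - k * p') (b := M + k * p + 1) (by omega)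
  rw [show M + k * p + 1 - 1 = M + k * p by ring] at p2
  rw [add_zero, show M - (k * p + 1) = M - k * p - 1 by ring,
    show M + (k * p + 1) = M + k * p + 1 by ring, p1, p2,
    show L - 1 + k * p' = L + k * p' - 1 by ring, show L - 1 + 1 - k * p' = L - k * p' by ring,
    show L + k * p' - 1 + 1 = L + k * p' by ring, show L - 1 - k * p' = L - k * p' - 1 by ring]
  have e0 : bosExpNeg p p' 1 0 k = bosExpPos p p' 1 0 k := by
    simp only [bosExpNeg, bosExpPos]; ring
  have k1 : qpow (bosExpPos p p' 1 0 k) * qpow (M - k * p) *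
      (gaussZ (L + k * p' - 1) (M - k * p) * gaussZ (L - k * p') (M + k * p)) =
      qpow M * qpow (bosExpPos p p' 1 1 k) *
      (gaussZ (L + k * p' - 1) (M - k * p) * gaussZ (L - k * p') (M + k * p)) := by
    by_cases hc : 0 ≤ M - k * p
    · rw [← qpow_add (bosExpPos_nonneg h0 k) hc, ← qpow_add hM (bosExpPos_nonneg h k)]
      congr 2
      simp only [bosExpPos]
      ring
    · rw [gaussZ_mul_gaussZ_eq_zero (by omega)]
      simp
  have k2 : qpow (bosExpPos p p' 1 0 k) * qpow (M + k * p + 1) *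
      (gaussZ (L + k * p') (M - k * p - 1) * gaussZ (L - k * p' - 1) (M + k * p + 1)) =
      qpow M * qpow (bosExpNeg p p' 1 1 k) *
      (gaussZ (L + k * p') (M - k * p - 1) * gaussZ (L - k * p' - 1) (M + k * p + 1)) := by
    by_cases hc : 0 ≤ M + k * p + 1
    · rw [← qpow_add (bosExpPos_nonneg h0 k) hc, ← qpow_add hM (bosExpNeg_nonneg h k)]
      congr 2
      simp only [bosExpPos, bosExpNeg]
      ring
    · rw [gaussZ_mul_gaussZ_eq_zero (by omega)]
      simp
  rw [e0]
  linear_combination k1 - k2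

theorem bosPoly_one_zero_zero (hp : 1 ≤ p) (hp' : 1 ≤ p') {M : ℤ} (hM : 0 ≤ M) :
    bosPoly p p' 1 0 0 M = if M = 0 then 1 else 0 := by
  unfold bosPoly bosSum
  rw [tsum_eq_single 0]
  · rcases eq_or_ne M 0 with rfl | hM0
    · simp [bosExpPos, bosExpNeg, qpow_zero, gaussZ_zero_left, gaussZ_of_neg_right]
    · simp [bosExpPos, bosExpNeg, qpow_zero, gaussZ_zero_left, hM, hM0,
        gaussZ_zero_left (show 0 ≤ M - 1 by omega), gaussZ_zero_left (show 0 ≤ M + 1 by omega)]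
  · intro k hk
    beta_reduce
    have hs := mul_sign_cases hp hp' k
    rw [gaussZ_mul_gaussZ_eq_zero (by omega), gaussZ_mul_gaussZ_eq_zero (by omega)]
    simp

theorem bosPoly_one_one_zero (hp : 1 ≤ p) (hp' : 2 ≤ p') {M : ℤ} (hM : 0 ≤ M) :
    bosPoly p p' 1 1 0 M = 1 := by
  unfold bosPoly bosSum
  -- This is where p' ≥ 2 matters: for p' = 1 the index k = -1 would contribute a second nonzero
  -- term.
  have hne : ∀ k : ℤ, k * p' + 1 ≠ 0 := by
    intro k hk
    have : p' ∣ 1 := ⟨-k, by linarith⟩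
    have := Int.le_of_dvd one_pos this
    omega
  rw [tsum_eq_single 0]
  · simp [bosExpPos, bosExpNeg, qpow_zero, gaussZ_zero_left hM, gaussZ_of_neg_left]
  · intro k hk
    beta_reduce
    have hs := mul_sign_cases (p' := p') hp (by omega) k
    have := hne k
    rw [gaussZ_mul_gaussZ_eq_zero (by omega), gaussZ_mul_gaussZ_eq_zero (by omega)]
    simp

/-- The k-th negative term is the (k+1)-st positive term, both having exponent (k+1)², so the sum
telescopes. -/
theorem bosPoly_one_one_one_one (L M : ℤ) : bosPoly 1 1 1 1 L M = 0 := by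
  have h := bosRange_one_one (p := 1) (p' := 1) le_rfl le_rfl
  let U : ℤ → ℤ⟦X⟧ := fun k => qpow (bosExpPos 1 1 1 1 k) *
    (gaussZ (L + k * 1) (M - k * 1) * gaussZ (L - k * 1) (M + k * 1))
  have hU : Summable U := summable_pos h _
  rw [← tsum_sub_comp_equiv (Equiv.addRight 1) hU]
  unfold bosPoly bosSum
  refine tsum_congr fun k => ?_
  simp only [U, Equiv.coe_addRight, bosExpPos, bosExpNeg]
  congr 3
  · ring
  all_goals simp only [mul_one]

/-- The Burge transform in the region where the weights are `q ^ (n (n + 1))`. -/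
theorem bosPoly_one_one_burge (hp : 1 ≤ p) (hp' : 1 ≤ p') {L : ℕ} (hL : 1 ≤ L) (M : ℕ) :
    bosPoly p (p' + p) 1 1 L M =
      ∑ n ∈ Finset.range (M + 1), qpow (n * (n + 1)) * gaussZ (2 * L) (M - n) *
        bosPoly p p' 1 1 (L - 1 - n) n := by
  have h := bosRange_one_one hp hp'
  -- The plain transform would raise s to 2. Rewriting the left side by a vertical step and each
  -- summand by a diagonal one puts both in the shape of `sum_burge` with ε = 1, which keeps s = 1.
  rw [bosPoly_one_one_eq_up hp (by omega) (by omega) (by omega)]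
  simp_rw [fun n : ℕ => bosPoly_one_one_eq_diag hp hp' (L - 1 - n) (Int.natCast_nonneg n)]
  refine sum_mul_bosSum h _ _ _ _ _ _ (fun k => ?_) (fun k => ?_)
  · have := sum_burge L M (x := L - 1 + k * p' - k * p) (y := L + 1 - k * p' + k * p) (b := k * p)
      (ε := 1) (bosExpPos_nonneg h k) (by ring) (Or.inr rfl)
      (by have := mul_sign_cases hp hp' k; omega)
    convert this using 1
    · refine Finset.sum_congr rfl fun n _ => ?_
      congr 3 <;> congr 1 <;> ring
    · congr 2
      · simp only [bosExpPos]; ring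
      · congr 1; ring
      · congr 1; ring
  · have := sum_burge L M (x := L + k * p' - k * p) (y := L - k * p' + k * p) (b := k * p)
      (ε := 1) (bosExpNeg_nonneg h k) (by ring) (Or.inr rfl)
      (by have := mul_sign_cases hp hp' k; omega)
    convert this using 1
    · refine Finset.sum_congr rfl fun n _ => ?_
      congr 3 <;> congr 1 <;> ring
    · congr 2
      · simp only [bosExpNeg]; ring
      · congr 1; ring
      · congr 1; ring

end

end

/-! ### Extension of the Burge transform to infinite bounds -/

section

open Filter Topology

theorem tendsto_toNat_atTop {α : ℕ → ℤ} (h : Tendsto α atTop atTop) :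
    Tendsto (fun j => (α j).toNat) atTop atTop := by
  rw [tendsto_atTop] at h ⊢
  intro b
  filter_upwards [h b] with j hj
  omega

theorem tendsto_gaussZ_left {α : ℕ → ℤ} (h : Tendsto α atTop atTop) (b : ℤ) :
    Tendsto (fun j => gaussZ (α j) b) atTop
      (𝓝 (if 0 ≤ b then recip (qPoch b.toNat) else 0)) := by
  split_ifs with hb
  · have h' := tendsto_toNat_atTop h
    have h1 := ((tendsto_qPoch.comp (tendsto_atTop_mono (fun j => Nat.le_add_right _ b.toNat) h')).mul
      (tendsto_recip_qPoch.comp h')).mul_const (recip (qPoch b.toNat))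
    rw [qPochInf_mul_recip, one_mul] at h1
    refine h1.congr' ?_
    filter_upwards [h.eventually_ge_atTop 0] with j hj
    simp [gaussZ, hj, hb, gaussN]
  · refine tendsto_const_nhds.congr fun j => ?_
    rw [gaussZ_of_neg_right _ (by omega)]

theorem tendsto_gaussZ_right {β : ℕ → ℤ} (h : Tendsto β atTop atTop) (a : ℤ) :
    Tendsto (fun j => gaussZ a (β j)) atTop
      (𝓝 (if 0 ≤ a then recip (qPoch a.toNat) else 0)) := by
  simp_rw [gaussZ_comm a]
  exact tendsto_gaussZ_left h a

theorem tendsto_gaussZ_both {α β : ℕ → ℤ} (hα : Tendsto α atTop atTop)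
    (hβ : Tendsto β atTop atTop) :
    Tendsto (fun j => gaussZ (α j) (β j)) atTop (𝓝 (recip qPochInf)) := by
  have hα' := tendsto_toNat_atTop hα
  have hβ' := tendsto_toNat_atTop hβ
  have h1 := ((tendsto_qPoch.comp (hα'.atTop_add_atTop hβ')).mul
    (tendsto_recip_qPoch.comp hα')).mul (tendsto_recip_qPoch.comp hβ')
  rw [qPochInf_mul_recip, one_mul] at h1
  refine h1.congr' ?_
  filter_upwards [hα.eventually_ge_atTop 0, hβ.eventually_ge_atTop 0] with j hj hj'
  simp [gaussZ, hj, hj', gaussN]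

/-- Both one-sided limits of a doubly bounded polynomial exist. -/
structure HasLimits (Φ : ℕ → ℕ → ℤ⟦X⟧) : Prop where
  left : ∀ M, ∃ y, Tendsto (fun L => Φ L M) atTop (𝓝 y)
  right : ∀ L, ∃ y, Tendsto (fun M => Φ L M) atTop (𝓝 y)

/-- Extension of a doubly bounded polynomial to infinite bounds; when both bounds are infinite
the limit is multiplied by `(q)_∞`. -/
def extend (Φ : ℕ → ℕ → ℤ⟦X⟧) (L M : ℕ∞) : ℤ⟦X⟧ :=
  if L = ⊤ then
    if M = ⊤ then qPochInf * limUnder atTop (fun j => Φ j j)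
    else limUnder atTop (fun j => Φ j M.toNat)
  else
    if M = ⊤ then limUnder atTop (fun j => Φ L.toNat j)
    else Φ L.toNat M.toNat

/-- The factor attached to a part `n` of a partition with parts at most `M` and weight at
most `L`. -/
def stepFactor (L M : ℕ∞) (n : ℕ) : ℤ⟦X⟧ :=
  if L = ⊤ then
    if M = ⊤ then 1 else recip (qPoch (M.toNat - n))
  else
    if M = ⊤ then recip (qPoch (2 * L.toNat)) else gaussZ (2 * (L.toNat : ℤ)) (M.toNat - n)

theorem extend_coe_coe (Φ : ℕ → ℕ → ℤ⟦X⟧) (L M : ℕ) : extend Φ L M = Φ L M := by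
  simp [extend]

theorem extend_top_coe {Φ : ℕ → ℕ → ℤ⟦X⟧} {M : ℕ} {y : ℤ⟦X⟧}
    (h : Tendsto (fun j => Φ j M) atTop (𝓝 y)) : extend Φ ⊤ M = y := by
  simp [extend, h.limUnder_eq]

theorem extend_coe_top {Φ : ℕ → ℕ → ℤ⟦X⟧} {L : ℕ} {y : ℤ⟦X⟧}
    (h : Tendsto (fun j => Φ L j) atTop (𝓝 y)) : extend Φ L ⊤ = y := by
  simp [extend, h.limUnder_eq]

theorem extend_top_top {Φ : ℕ → ℕ → ℤ⟦X⟧} {y : ℤ⟦X⟧}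
    (h : Tendsto (fun j => Φ j j) atTop (𝓝 y)) : extend Φ ⊤ ⊤ = qPochInf * y := by
  simp [extend, h.limUnder_eq]

theorem HasLimits.tendsto_left {Φ : ℕ → ℕ → ℤ⟦X⟧} (h : HasLimits Φ) (M : ℕ) :
    Tendsto (fun j => Φ j M) atTop (𝓝 (extend Φ ⊤ M)) := by
  obtain ⟨y, hy⟩ := h.left M
  rwa [extend_top_coe hy]

theorem HasLimits.tendsto_right {Φ : ℕ → ℕ → ℤ⟦X⟧} (h : HasLimits Φ) (L : ℕ) :
    Tendsto (fun j => Φ L j) atTop (𝓝 (extend Φ L ⊤)) := by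
  obtain ⟨y, hy⟩ := h.right L
  rwa [extend_coe_top hy]

theorem extend_swap {Φ Ψ : ℕ → ℕ → ℤ⟦X⟧} (h : ∀ L M, Φ L M = Ψ M L) (L M : ℕ∞) :
    extend Φ L M = extend Ψ M L := by
  unfold extend
  simp only [h]
  split_ifs <;> rfl

/-- The summand of the Burge transform. -/
def stepTerm (e : ℕ → ℕ) (Ψ : ℕ → ℕ → ℤ⟦X⟧) (L M : ℕ∞) (n : ℕ) : ℤ⟦X⟧ :=
  if (n : ℕ∞) ≤ L ∧ (n : ℕ∞) ≤ M then
    PowerSeries.X ^ e n * stepFactor L M n * extend Ψ (L - n) n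
  else 0

/-- `Φ` is the Burge transform of `Ψ` with weights `q ^ e n`. -/
def IsBurgeStep (e : ℕ → ℕ) (Φ Ψ : ℕ → ℕ → ℤ⟦X⟧) : Prop :=
  ∀ L M : ℕ, HasSum (stepTerm e Ψ L M) (Φ L M)

theorem stepTerm_coe_coe (e : ℕ → ℕ) (Ψ : ℕ → ℕ → ℤ⟦X⟧) (L M n : ℕ) :
    stepTerm e Ψ L M n = if n ≤ L ∧ n ≤ M then
      PowerSeries.X ^ e n * gaussZ (2 * L) (M - n) * Ψ (L - n) n else 0 := by
  unfold stepTerm stepFactor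
  simp only [Nat.cast_le, ENat.natCast_ne_top, if_false, ENat.toNat_natCast]
  rw [← ENat.natCast_sub, extend_coe_coe]

theorem tendsto_two_mul_natCast : Tendsto (fun j : ℕ => 2 * (j : ℤ)) atTop atTop :=
  tendsto_natCast_atTop_atTop.const_mul_atTop' two_pos

theorem tendsto_natCast_add (c : ℤ) : Tendsto (fun j : ℕ => (j : ℤ) + c) atTop atTop :=
  tendsto_atTop_add_const_right _ c tendsto_natCast_atTop_atTop

theorem tendsto_natCast_sub (c : ℤ) : Tendsto (fun j : ℕ => (j : ℤ) - c) atTop atTop :=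
  tendsto_natCast_add (-c)

open PowerSeries in
theorem hasSum_of_tendsto_step {e : ℕ → ℕ} (he : ∀ n, n ≤ e n + 1) {t : ℕ → ℕ → ℤ⟦X⟧}
    {φ : ℕ → ℤ⟦X⟧} {t₀ : ℕ → ℤ⟦X⟧} (ht : ∀ j, HasSum (t j) (φ j))
    (hd : ∀ j n, X ^ e n ∣ t j n) (hlim : ∀ n, Tendsto (fun j => t j n) atTop (𝓝 (t₀ n))) :
    ∃ y, Tendsto φ atTop (𝓝 y) ∧ HasSum t₀ y := by
  -- Since e n ≥ n - 1, all terms with n > N are divisible by X^N uniformly in j.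
  obtain ⟨hs, hy⟩ := tendsto_tsum_of_dvd (F := t) (f := t₀) (l := atTop) (fun N =>
    ⟨Finset.range (N + 1), fun j n hn => (pow_dvd_pow _ (by
      have := he n
      rw [Finset.mem_range] at hn
      omega)).trans (hd j n)⟩) hlim
  exact ⟨_, hy.congr fun j => (ht j).tsum_eq, hs.hasSum⟩

open PowerSeries in
theorem IsBurgeStep.hasSum {e : ℕ → ℕ} (he : ∀ n, n ≤ e n + 1) {Φ Ψ : ℕ → ℕ → ℤ⟦X⟧}
    (h : IsBurgeStep e Φ Ψ) (hΨ : HasLimits Ψ) (L M : ℕ∞) :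
    HasSum (stepTerm e Ψ L M) (extend Φ L M) := by
  have hd : ∀ (L M n : ℕ), X ^ e n ∣ stepTerm e Ψ L M n := by
    intro L M n
    unfold stepTerm
    split_ifs
    · rw [mul_assoc]; exact dvd_mul_right _ _
    · exact dvd_zero _
  induction L using ENat.recTopCoe with
  | top =>
    induction M using ENat.recTopCoe with
    | top =>
      -- With both bounds infinite the Gaussian tends to 1/(q)_∞; the factor (q)_∞ built into
      -- `extend` cancels it, so `stepFactor` is 1 in this case.
      obtain ⟨y, hy, hs⟩ := hasSum_of_tendsto_step he (t := fun j => stepTerm e Ψ j j)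
        (φ := fun j => Φ j j) (t₀ := fun n => recip qPochInf * stepTerm e Ψ ⊤ ⊤ n)
        (fun j => h j j) (fun j => hd j j) (fun n => by
          have h1 := ((tendsto_gaussZ_both tendsto_two_mul_natCast
            (tendsto_natCast_sub n)).const_mul (X ^ e n : ℤ⟦X⟧)).mul
            ((hΨ.tendsto_left n).comp (tendsto_sub_atTop_nat n))
          have h2 : recip qPochInf * stepTerm e Ψ ⊤ ⊤ n =
              X ^ e n * recip qPochInf * extend Ψ ⊤ n := by
            simp only [stepTerm, stepFactor, le_top, and_self, if_true, ENat.top_sub_natCast]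
            ring
          rw [h2]
          refine h1.congr' ?_
          filter_upwards [eventually_ge_atTop n] with j hj
          simp [stepTerm_coe_coe, hj])
      rw [extend_top_top hy]
      have := hs.mul_left qPochInf
      simpa only [← mul_assoc, qPochInf_mul_recip, one_mul] using this
    | coe M =>
      obtain ⟨y, hy, hs⟩ := hasSum_of_tendsto_step he (t := fun j => stepTerm e Ψ j M)
        (φ := fun j => Φ j M) (t₀ := stepTerm e Ψ ⊤ M)
        (fun j => h j M) (fun j => hd j M) (fun n => by
          rcases le_or_gt n M with hn | hn
          · have h1 := ((tendsto_gaussZ_left tendsto_two_mul_natCast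
              ((M : ℤ) - n)).const_mul (X ^ e n : ℤ⟦X⟧)).mul
              ((hΨ.tendsto_left n).comp (tendsto_sub_atTop_nat n))
            have h2 : stepTerm e Ψ ⊤ M n =
                X ^ e n * recip (qPoch ((M : ℤ) - n).toNat) * extend Ψ ⊤ n := by
              simp [stepTerm, stepFactor, hn]
            rw [h2]
            rw [if_pos (by omega)] at h1
            refine h1.congr' ?_
            filter_upwards [eventually_ge_atTop n] with j hj
            simp [stepTerm_coe_coe, hj, hn]
          · simp [stepTerm, hn.not_ge])
      rwa [extend_top_coe hy]
  | coe L =>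
    induction M using ENat.recTopCoe with
    | top =>
      obtain ⟨y, hy, hs⟩ := hasSum_of_tendsto_step he (t := fun j => stepTerm e Ψ L j)
        (φ := fun j => Φ L j) (t₀ := stepTerm e Ψ L ⊤)
        (fun j => h L j) (fun j => hd L j) (fun n => by
          rcases le_or_gt n L with hn | hn
          · have h1 := ((tendsto_gaussZ_right (tendsto_natCast_sub n)
              (2 * (L : ℤ))).const_mul (X ^ e n : ℤ⟦X⟧)).mul_const (Ψ (L - n) n)
            have h2 : stepTerm e Ψ L ⊤ n =
                X ^ e n * recip (qPoch (2 * (L : ℤ)).toNat) * Ψ (L - n) n := by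
              have : (2 * (L : ℤ)).toNat = 2 * L := by omega
              rw [this]
              simp only [stepTerm, stepFactor, Nat.cast_le, hn, le_top, and_self, if_true,
                ENat.natCast_ne_top, if_false, ENat.toNat_natCast]
              rw [← ENat.natCast_sub, extend_coe_coe]
            rw [h2]
            rw [if_pos (by omega)] at h1
            refine h1.congr' ?_
            filter_upwards [eventually_ge_atTop n] with j hj
            simp [stepTerm_coe_coe, hj, hn]
          · simp [stepTerm, hn.not_ge])
      rwa [extend_coe_top hy]
    | coe M =>
      rw [extend_coe_coe]
      exact h L M

end

/-! ### The two families of bosonic polynomials and their relations -/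

section

open Filter Topology

theorem tendsto_natCast_add_const_of_eq {α : ℕ → ℤ} (c : ℤ) (h : ∀ j : ℕ, α j = j + c) :
    Tendsto α atTop atTop := by
  rw [show α = fun j : ℕ => (j : ℤ) + c from funext h]
  exact tendsto_natCast_add c

/-- The bosonic polynomial on natural bounds. -/
def bosFin (p p' r s : ℤ) (L M : ℕ) : ℤ⟦X⟧ := bosPoly p p' r s L M

/-- The bosonic polynomial for `r = s = 1` with shifted second bound. -/
def bosShift (p p' : ℤ) (L M : ℕ) : ℤ⟦X⟧ :=
  if M = 0 then (if L = 0 then 1 else 0) else bosPoly p p' 1 1 L ((M : ℤ) - 1)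

theorem tendsto_bosPoly_left {p p' r s : ℤ} (h : BosRange p p' r s) (M : ℤ) :
    ∃ y, Tendsto (fun L : ℕ => bosPoly p p' r s L M) atTop (𝓝 y) :=
  ⟨_, tendsto_bosSum h
    (fun _ => (tendsto_gaussZ_left (tendsto_natCast_add_const_of_eq _ fun _ => rfl) _).mul
      (tendsto_gaussZ_left (tendsto_natCast_add_const_of_eq _ fun _ => sub_eq_add_neg _ _) _))
    (fun _ => (tendsto_gaussZ_left (tendsto_natCast_add_const_of_eq _ fun _ => rfl) _).mul
      (tendsto_gaussZ_left (tendsto_natCast_add_const_of_eq _ fun _ => sub_eq_add_neg _ _) _))⟩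

theorem tendsto_bosPoly_right {p p' r s : ℤ} (h : BosRange p p' r s) (L : ℤ) :
    ∃ y, Tendsto (fun M : ℕ => bosPoly p p' r s L M) atTop (𝓝 y) := by
  simp_rw [bosPoly_swap h]
  exact tendsto_bosPoly_left h.swap L

theorem tendsto_bosPoly_diag {p p' r s : ℤ} (h : BosRange p p' r s) :
    Tendsto (fun j : ℕ => bosPoly p p' r s j j) atTop
      (𝓝 (recip qPochInf * recip qPochInf * bosSum p p' r s (fun _ => 1) fun _ => 1)) := by
  have h1 : bosSum p p' r s (fun _ => recip qPochInf * recip qPochInf)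
      (fun _ => recip qPochInf * recip qPochInf) =
      recip qPochInf * recip qPochInf * bosSum p p' r s (fun _ => 1) fun _ => 1 := by
    unfold bosSum
    rw [← Summable.tsum_mul_left _ ((summable_pos h _).sub (summable_neg h _))]
    refine tsum_congr fun k => ?_
    ring
  rw [← h1]
  have a1 : ∀ c : ℤ, Tendsto (fun j : ℕ => (j : ℤ) + c) atTop atTop :=
    fun c => tendsto_natCast_add c
  have a2 : ∀ c : ℤ, Tendsto (fun j : ℕ => (j : ℤ) - c) atTop atTop :=
    fun c => tendsto_natCast_sub c
  exact tendsto_bosSum h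
    (fun k => (tendsto_gaussZ_both (a1 _) (a2 _)).mul (tendsto_gaussZ_both (a2 _) (a1 _)))
    (fun k => (tendsto_gaussZ_both (a1 _) (a2 _)).mul (tendsto_gaussZ_both (a2 _) (a1 _)))

theorem hasLimits_bosFin {p p' r s : ℤ} (h : BosRange p p' r s) : HasLimits (bosFin p p' r s) :=
  ⟨fun M => tendsto_bosPoly_left h M, fun L => tendsto_bosPoly_right h L⟩

theorem extend_bosFin_top_top {p p' r s : ℤ} (h : BosRange p p' r s) :
    extend (bosFin p p' r s) ⊤ ⊤ =
      recip qPochInf * bosSum p p' r s (fun _ => 1) fun _ => 1 := by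
  rw [extend_top_top (tendsto_bosPoly_diag h), ← mul_assoc, ← mul_assoc, qPochInf_mul_recip,
    one_mul]

theorem isBurgeStep_of_sum {e : ℕ → ℕ} {Φ Ψ : ℕ → ℕ → ℤ⟦X⟧}
    (h : ∀ L M, Φ L M = ∑ n ∈ Finset.range (M + 1), if n ≤ L then
      PowerSeries.X ^ e n * gaussZ (2 * L) (M - n) * Ψ (L - n) n else 0) :
    IsBurgeStep e Φ Ψ := by
  intro L M
  have h1 : Φ L M = ∑ n ∈ Finset.range (M + 1), stepTerm e Ψ L M n := by
    rw [h]
    refine Finset.sum_congr rfl fun n hn => ?_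
    have hn' : n ≤ M := by simpa [Nat.lt_succ_iff] using hn
    simp [stepTerm_coe_coe, hn']
  rw [h1]
  refine hasSum_sum_of_ne_finset_zero fun n hn => ?_
  rw [stepTerm_coe_coe, if_neg]
  rw [Finset.mem_range] at hn
  omega

theorem isBurgeStep_bosFin {p p' r s : ℤ} (h : BosRange p p' r s) :
    IsBurgeStep (fun n => n ^ 2) (bosFin p (p' + p) r (s + r)) (bosFin p p' r s) := by
  refine isBurgeStep_of_sum fun L M => ?_
  unfold bosFin
  rw [bosPoly_burge h]
  refine Finset.sum_congr rfl fun n _ => ?_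
  split_ifs with hn
  · rw [Nat.cast_sub hn, ← qpow_natCast]
    congr 3
    push_cast
    ring
  · rw [bosPoly_of_neg _ _ _ _ _ (by omega), mul_zero]

theorem hasLimits_bosShift {p p' : ℤ} (hp : 1 ≤ p) (hp' : 1 ≤ p') :
    HasLimits (bosShift p p') := by
  have h := bosRange_one_one hp hp'
  constructor
  · intro M
    rcases eq_or_ne M 0 with rfl | hM
    · refine ⟨0, tendsto_const_nhds.congr' ?_⟩
      filter_upwards [eventually_ne_atTop 0] with L hL
      simp [bosShift, hL]
    · simpa [bosShift, hM] using tendsto_bosPoly_left h ((M : ℤ) - 1)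
  · intro L
    obtain ⟨y, hy⟩ := tendsto_bosPoly_right h L
    refine ⟨y, (hy.comp (tendsto_sub_atTop_nat 1)).congr' ?_⟩
    filter_upwards [eventually_ge_atTop 1] with M hM
    have : M ≠ 0 := by omega
    simp [bosShift, this, Nat.cast_sub hM]

theorem isBurgeStep_bosShift {p p' : ℤ} (hp : 1 ≤ p) (hp' : 1 ≤ p') :
    IsBurgeStep (fun n => n * (n - 1)) (bosShift p (p' + p)) (bosShift p p') := by
  refine isBurgeStep_of_sum fun L M => ?_
  have h0 : ∀ M : ℕ, (if 0 ≤ L then PowerSeries.X ^ (0 * (0 - 1)) *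
      gaussZ (2 * L) ((M : ℤ) - (0 : ℕ)) * bosShift p p' (L - 0) 0 else 0) =
      if L = 0 then 1 else 0 := by
    intro M
    rcases eq_or_ne L 0 with rfl | hL
    · simp [bosShift, gaussZ_zero_left]
    · simp [bosShift, hL]
  -- The part n = 0 contributes only when L = 0; the remaining parts n + 1 carry the weights
  -- q^{n(n+1)} of the unshifted transform.
  rw [Finset.sum_range_succ', h0]
  cases M with
  | zero => simp [bosShift]
  | succ M =>
    rcases Nat.eq_zero_or_pos L with rfl | hL
    · simp [bosShift, bosPoly_one_one_zero hp (show 2 ≤ p' + p by omega)]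
    · simp only [bosShift, Nat.add_eq_zero_iff, one_ne_zero, and_false, if_false, hL.ne',
        add_zero, Nat.cast_add, Nat.cast_one, add_sub_cancel_right]
      rw [bosPoly_one_one_burge hp hp' hL]
      refine Finset.sum_congr rfl fun n _ => ?_
      split_ifs with hn
      · rw [Nat.cast_sub hn, ← qpow_natCast, Nat.add_sub_cancel]
        push_cast
        rw [show (L : ℤ) - (n + 1) = L - 1 - n by ring, show (M : ℤ) + 1 - (n + 1) = M - n by ring,
          mul_comm ((n : ℤ) + 1)]
      · rw [bosPoly_of_neg _ _ _ _ _ (by omega), mul_zero]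

/-- The two bounds may be exchanged when both are finite or one of them is. -/
theorem extend_bosFin_swap {p p' r s : ℤ} (h : BosRange p p' r s) (L M : ℕ∞) :
    extend (bosFin p p' r s) L M = extend (bosFin p' p s r) M L :=
  extend_swap (fun _ _ => bosPoly_swap h _ _) L M

theorem bosFin_one_zero {p p' : ℤ} (hp : 1 ≤ p) (hp' : 1 ≤ p') (L M : ℕ) :
    bosFin p p' 1 0 L M = if L = 0 then (if M = 0 then 1 else 0) else
      PowerSeries.X ^ M * bosShift p p' (L - 1) (M + 1) := by
  unfold bosFin
  split_ifs with hL hM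
  · subst hL hM
    simpa using bosPoly_one_zero_zero hp hp' le_rfl
  · subst hL
    simpa [hM] using bosPoly_one_zero_zero hp hp' (Int.natCast_nonneg M)
  · rw [bosPoly_one_zero hp hp' (by omega) (by omega), qpow_natCast]
    simp [bosShift, Nat.cast_sub (Nat.one_le_iff_ne_zero.2 hL)]

theorem extend_bosFin_one_zero {p p' : ℤ} (hp : 1 ≤ p) (hp' : 1 ≤ p') (L : ℕ∞) (M : ℕ) :
    extend (bosFin p p' 1 0) L M = if L = 0 then (if M = 0 then 1 else 0) else
      PowerSeries.X ^ M * extend (bosShift p p') (L - 1) (M + 1) := by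
  induction L using ENat.recTopCoe with
  | top =>
    have h := ((hasLimits_bosShift hp hp').tendsto_left (M + 1)).comp (tendsto_sub_atTop_nat 1)
    rw [if_neg (by simp), extend_top_coe ((h.const_mul (PowerSeries.X ^ M)).congr' ?_)]
    · simp
    · filter_upwards [eventually_ne_atTop 0] with j hj
      simp [bosFin_one_zero hp hp', hj]
  | coe L =>
    rw [extend_coe_coe, bosFin_one_zero hp hp']
    simp only [Nat.cast_eq_zero]
    congr 2

/-- Exchanging the bounds moves the unit shift from one to the other, which produces the ±1 in
n_{k,0} and w_k for k ≥ u + 2. The case M = 0 is where a sequence may stop. -/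
theorem bosShift_eq {p p' : ℤ} (hp : 1 ≤ p) (hp' : 1 ≤ p') (L M : ℕ) :
    bosShift p p' L M = if M = 0 then (if L = 0 then 1 else 0) else
      bosShift p' p (M - 1) (L + 1) := by
  rcases eq_or_ne M 0 with rfl | hM
  · simp [bosShift]
  · simp [bosShift, hM, bosPoly_swap (bosRange_one_one hp hp'),
      Nat.cast_sub (Nat.one_le_iff_ne_zero.2 hM)]

theorem extend_bosShift {p p' : ℤ} (hp : 1 ≤ p) (hp' : 1 ≤ p') {L M : ℕ∞}
    (h : L ≠ ⊤ ∨ M ≠ ⊤) :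
    extend (bosShift p p') L M = if M = 0 then (if L = 0 then 1 else 0) else
      extend (bosShift p' p) (M - 1) (L + 1) := by
  induction L using ENat.recTopCoe with
  | top =>
    induction M using ENat.recTopCoe with
    | top => simp at h
    | coe M =>
      rcases eq_or_ne M 0 with rfl | hM
      · rw [extend_top_coe (y := 0)]
        · simp
        · refine tendsto_const_nhds.congr' ?_
          filter_upwards [eventually_ne_atTop 0] with L hL
          simp [bosShift, hL]
      · rw [if_neg (by exact_mod_cast hM)]
        have h := ((hasLimits_bosShift hp' hp).tendsto_right (M - 1)).comp
          (tendsto_add_atTop_nat 1)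
        rw [extend_top_coe (h.congr fun j => ?_)]
        · simp
        · simp [bosShift_eq hp hp' _ M, hM]
  | coe L =>
    induction M using ENat.recTopCoe with
    | top =>
      have h := ((hasLimits_bosShift hp' hp).tendsto_left (L + 1)).comp (tendsto_sub_atTop_nat 1)
      rw [if_neg (by simp), extend_coe_top (h.congr' ?_)]
      · simp
      · filter_upwards [eventually_ne_atTop 0] with j hj
        simp [bosShift_eq hp hp' L j, hj]
    | coe M =>
      rw [extend_coe_coe, bosShift_eq hp hp']
      simp only [Nat.cast_eq_zero]
      congr 1

/-- For L > 0 and M > 0 one transform reduces the parameters to p = p' = 1, where the polynomials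
vanish identically. -/
theorem bosShift_one_two (L M : ℕ) : bosShift 1 2 L M = if L = 0 then 1 else 0 := by
  unfold bosShift
  split_ifs with h1 h2 h2
  · rfl
  · rfl
  · subst h2
    exact bosPoly_one_one_zero le_rfl le_rfl (by omega)
  · obtain ⟨M, rfl⟩ := Nat.exists_eq_succ_of_ne_zero h1
    have := bosPoly_one_one_burge (p := 1) (p' := 1) le_rfl le_rfl
      (Nat.one_le_iff_ne_zero.2 h2) M
    simp only [bosPoly_one_one_one_one, mul_zero, Finset.sum_const_zero] at this
    simpa using this

theorem extend_bosShift_one_two {L M : ℕ∞} (h : L ≠ ⊤ ∨ M ≠ ⊤) :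
    extend (bosShift 1 2) L M = if L = 0 then 1 else 0 := by
  induction L using ENat.recTopCoe with
  | top =>
    induction M using ENat.recTopCoe with
    | top => simp at h
    | coe M =>
      rw [extend_top_coe (y := 0)]
      · simp
      · refine tendsto_const_nhds.congr' ?_
        filter_upwards [eventually_ne_atTop 0] with L hL
        simp [bosShift_one_two, hL]
  | coe L =>
    induction M using ENat.recTopCoe with
    | top =>
      rw [extend_coe_top (y := if L = 0 then 1 else 0)]
      · simp
      · simp_rw [bosShift_one_two]
        exact tendsto_const_nhds
    | coe M => simp [extend_coe_coe, bosShift_one_two]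

end

/-! ### Prefixes of sequences of partitions, and their weights -/

section

variable {t u : ℕ} {f : ℕ → ℕ} {n n' : ℕ → ℕ → ℕ} {k i : ℕ}

theorem part_of_pos (h : 1 ≤ i) : part u f n k i = n k i := by
  simp [part, Nat.one_le_iff_ne_zero.1 h]

theorem part_zero : part u f n k 0 = (bounds u f n k).1 := by simp [part]

theorem bounds_succ (hk : 1 ≤ k) : bounds u f n (k + 1) =
    if k < u then (wBound u f n k - (wt f n k : ℕ∞), part u f n k (f k))
    else if k = u then (part u f n k (f k) + 1, wBound u f n k - 1 - (wt f n k : ℕ∞))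
    else (wBound u f n k + 1 - (wt f n k : ℕ∞), part u f n k (f k) - 1) := by
  obtain ⟨k, rfl⟩ := Nat.exists_eq_add_of_le' hk
  have : part u f n (k + 1) (f (k + 1)) =
      if f (k + 1) = 0 then (bounds u f n (k + 1)).1 else (n (k + 1) (f (k + 1)) : ℕ∞) := rfl
  rw [this, wBound, bounds]
  have h2 : (k + 2 = u + 1) = (k + 1 = u) := by
    rw [eq_iff_iff]
    omega
  simp only [Nat.succ_le_iff, h2]

theorem bounds_congr (h : ∀ k', 1 ≤ k' → k' < k → n k' = n' k') :
    bounds u f n k = bounds u f n' k := by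
  induction k with
  | zero => rfl
  | succ k ih =>
    rcases Nat.eq_zero_or_pos k with rfl | hk
    · rfl
    · have h1 := ih fun k' h1 h2 => h k' h1 (by omega)
      have h2 := h k hk (by omega)
      rw [bounds_succ hk, bounds_succ hk]
      simp only [wBound, part, wt, h1, h2]

theorem wt_eq_sum_of_support (hi : i ≤ f k) (h : ∀ j, i < j → n k j = 0) :
    wt f n k = ∑ j ∈ Finset.Icc 1 i, n k j := by
  unfold wt
  symm
  refine Finset.sum_subset (Finset.Icc_subset_Icc_right hi) fun j hj hj' => h j ?_
  rw [Finset.mem_Icc] at hj hj'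
  omega

/-- The array `n` consists of the first `k - 1` partitions and the first `i` parts of the `k`-th
partition of a possible sequence. -/
structure IsPrefix (u : ℕ) (f : ℕ → ℕ) (k i : ℕ) (n : ℕ → ℕ → ℕ) : Prop where
  support : ∀ k' j, n k' j ≠ 0 → 1 ≤ k' ∧ k' ≤ k ∧ 1 ≤ j ∧ j ≤ f k' ∧ (k' = k → j ≤ i)
  antitone : ∀ k', 1 ≤ k' → k' ≤ k → ∀ j, 1 ≤ j → j ≤ f k' →
    part u f n k' j ≤ part u f n k' (j - 1)
  wt_le : ∀ k', 1 ≤ k' → k' ≤ k → (wt f n k' : ℕ∞) ≤ wBound u f n k'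
  wt_lt : u < k → (wt f n u : ℕ∞) < wBound u f n u
  pos : ∀ k', u < k' → k' < k → 0 < part u f n k' (f k')

theorem isAdmissible_iff {x : ℕ} : IsAdmissible t u f x n ↔ (u ≤ x ∧ x ≤ t + 1) ∧
    IsPrefix u f x (f x) n ∧ (wt f n x : ℕ∞) = wBound u f n x ∧
      (x < t + 1 → part u f n x (f x) = 0) := by
  constructor
  · intro h
    refine ⟨⟨h.u_le, h.le_t⟩, ⟨fun k' j hn => ?_, h.antitone, h.wt_le, h.wt_lt, h.pos⟩, h.wt_last,
      h.last_zero⟩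
    have := h.support k' j hn
    refine ⟨this.1.1, this.1.2, this.2.1, this.2.2, ?_⟩
    rintro rfl
    exact this.2.2
  · rintro ⟨⟨h1, h2⟩, h, h3, h4⟩
    refine ⟨h1, h2, fun k' j hn => ?_, h.antitone, h.wt_le, h3, h.wt_lt, h.pos, h4⟩
    have := h.support k' j hn
    exact ⟨⟨this.1, this.2.1⟩, this.2.2.1, this.2.2.2.1⟩

theorem IsPrefix.eq_zero (h : IsPrefix u f k i n) {j : ℕ} (hj : i < j) : n k j = 0 := by
  by_contra hn
  have := (h.support k j hn).2.2.2.2 rfl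
  omega

theorem IsPrefix.wt_eq (h : IsPrefix u f k i n) (hi : i ≤ f k) :
    wt f n k = ∑ j ∈ Finset.Icc 1 i, n k j :=
  wt_eq_sum_of_support hi fun _ hj => h.eq_zero hj

theorem IsPrefix.part_le (h : IsPrefix u f k i n) {k' : ℕ} (h1 : 1 ≤ k') (h2 : k' ≤ k) {j : ℕ}
    (hj : j ≤ f k') : part u f n k' j ≤ part u f n k' 0 := by
  induction j with
  | zero => exact le_rfl
  | succ j ih => exact (h.antitone k' h1 h2 (j + 1) (by omega) hj).trans (ih (by omega))

theorem le_wt {j : ℕ} (h1 : 1 ≤ j) (h2 : j ≤ f k) : n k j ≤ wt f n k :=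
  Finset.single_le_sum (f := fun j => n k j) (fun _ _ => Nat.zero_le _)
    (Finset.mem_Icc.2 ⟨h1, h2⟩)

/-- Both bounds of the first row are infinite, but its last part becomes a bound of the second. Each
later transition turns a finite bound of one kind into a finite bound of some kind, at most one
larger; hence the first partition controls all others. -/
theorem IsPrefix.bound (h : IsPrefix u f k i n) (hf : 1 ≤ f 1) {N : ℕ} (hN : ∀ j, n 1 j ≤ N)
    {k' : ℕ} (h2 : 2 ≤ k') (hk' : k' ≤ k) :
    wBound u f n k' ≤ (N + k' : ℕ) ∨ part u f n k' 0 ≤ (N + k' : ℕ) := by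
  induction k', h2 using Nat.le_induction with
  | base =>
    have hp : part u f n 1 (f 1) ≤ (N : ℕ∞) := by
      rw [part_of_pos hf]
      exact_mod_cast hN _
    rw [wBound, part_zero, bounds_succ le_rfl]
    split_ifs
    · exact Or.inl (hp.trans (by exact_mod_cast Nat.le_add_right _ _))
    · refine Or.inr ((add_le_add_left hp 1).trans ?_)
      exact_mod_cast Nat.add_le_add_left one_le_two N
    · exact Or.inl ((tsub_le_self.trans hp).trans (by exact_mod_cast Nat.le_add_right _ _))
  | succ k' h2 ih =>
    have ih := ih (by omega)
    have hlast := h.part_le (k' := k') (by omega) (by omega) le_rfl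
    have e1 : ((N + k' : ℕ) : ℕ∞) ≤ (N + (k' + 1) : ℕ) := by
      exact_mod_cast (by omega : N + k' ≤ N + (k' + 1))
    have e2 : ((N + k' : ℕ) : ℕ∞) + 1 = (N + (k' + 1) : ℕ) := by
      push_cast; ring
    rw [wBound, part_zero, bounds_succ (by omega)]
    split_ifs
    · exact ih.symm.imp (fun h => (hlast.trans h).trans e1)
        (fun h => (tsub_le_self.trans h).trans e1)
    · refine ih.imp (fun h => ?_) (fun h => ?_)
      · exact (tsub_le_self.trans (tsub_le_self.trans h)).trans e1
      · rw [← e2]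
        exact add_le_add_left (hlast.trans h) 1
    · refine ih.symm.imp (fun h => ?_) (fun h => ?_)
      · exact (tsub_le_self.trans (hlast.trans h)).trans e1
      · rw [← e2]
        exact tsub_le_self.trans (add_le_add_left h 1)

theorem IsPrefix.apply_le (h : IsPrefix u f k i n) (hf : 1 ≤ f 1) {N : ℕ} (hN : ∀ j, n 1 j ≤ N)
    (k' j : ℕ) : n k' j ≤ N + k' := by
  by_cases hn : n k' j = 0
  · omega
  obtain ⟨h1, h2, h3, h4, -⟩ := h.support k' j hn
  rcases eq_or_lt_of_le h1 with rfl | h1'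
  · exact (hN j).trans (by omega)
  · rcases h.bound hf hN h1' h2 with hb | hb
    · have := (Nat.cast_le (α := ℕ∞).2 (le_wt (n := n) h3 h4)).trans ((h.wt_le k' h1 h2).trans hb)
      exact_mod_cast this
    · have := (h.part_le h1 h2 h4).trans hb
      rw [part_of_pos h3] at this
      exact_mod_cast this

theorem finite_arrays (K F N : ℕ) : {n : ℕ → ℕ → ℕ | (∀ k j, n k j ≤ N) ∧
    ∀ k j, n k j ≠ 0 → k ≤ K ∧ j ≤ F}.Finite := by
  -- The reduction modulo N + 1 in `Fin.ofNat` changes nothing, since all entries are at most N.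
  let φ : (ℕ → ℕ → ℕ) → (Fin (K + 1) × Fin (F + 1) → Fin (N + 1)) :=
    fun n p => Fin.ofNat (N + 1) (n p.1 p.2)
  refine Set.Finite.of_injOn (f := φ) (t := Set.univ) (fun _ _ => Set.mem_univ _) ?_
    Set.finite_univ
  rintro n ⟨hn, hn'⟩ m ⟨hm, hm'⟩ h
  funext k j
  by_cases hkj : k ≤ K ∧ j ≤ F
  · have := congrArg Fin.val (congrFun h (⟨k, by omega⟩, ⟨j, by omega⟩))
    simp only [φ, Fin.val_ofNat] at this
    rwa [Nat.mod_eq_of_lt (Nat.lt_succ_of_le (hn k j)),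
      Nat.mod_eq_of_lt (Nat.lt_succ_of_le (hm k j))] at this
  · have h1 : n k j = 0 := by_contra fun h => hkj (hn' k j h)
    have h2 : m k j = 0 := by_contra fun h => hkj (hm' k j h)
    rw [h1, h2]

theorem IsPrefix.exists_le (h : IsPrefix u f k i n) : ∃ N, ∀ j, n 1 j ≤ N :=
  ⟨∑ j ∈ Finset.Icc 1 (f 1), n 1 j, fun j => by
    by_cases hn : n 1 j = 0
    · omega
    obtain ⟨-, -, h3, h4, -⟩ := h.support 1 j hn
    exact le_wt h3 h4⟩

/-- Supplies the side condition of the exchange and terminal relations, which are not claimed when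
both bounds are infinite. -/
theorem IsPrefix.ne_top (h : IsPrefix u f k i n) (hf : 1 ≤ f 1) (hk : 2 ≤ k) {j : ℕ}
    (hj : j ≤ f k) (a : ℕ∞) : wBound u f n k - a ≠ ⊤ ∨ part u f n k j ≠ ⊤ := by
  obtain ⟨N, hN⟩ := h.exists_le
  refine (h.bound hf hN hk le_rfl).imp (fun hb => ?_) (fun hb => ?_)
  · exact ((tsub_le_self.trans hb).trans_lt (ENat.natCast_lt_top _)).ne
  · exact (((h.part_le (by omega) le_rfl hj).trans hb).trans_lt (ENat.natCast_lt_top _)).ne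

/-- The exponent contributed by a part `m` of the `k`-th partition. -/
def partExp (u k m : ℕ) : ℕ := if k ≤ u then m ^ 2 else m * (m - 1)

/-- The weight contributed by the `j`-th part of the `k`-th partition. -/
def partWeight (u : ℕ) (f : ℕ → ℕ) (n : ℕ → ℕ → ℕ) (k j : ℕ) : ℤ⟦X⟧ :=
  PowerSeries.X ^ partExp u k (n k j) *
    stepFactor (wBound u f n k - ((∑ l ∈ Finset.Ico 1 j, n k l : ℕ) : ℕ∞))
      (part u f n k (j - 1)) (n k j)

/-- The weight of the first `k - 1` partitions and the first `i` parts of the `k`-th one. -/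
def prefixWeight (u : ℕ) (f : ℕ → ℕ) (k i : ℕ) (n : ℕ → ℕ → ℕ) : ℤ⟦X⟧ :=
  (if u < k then PowerSeries.X ^ n u (f u) else 1) *
    ((∏ k' ∈ Finset.Ico 1 k, ∏ j ∈ Finset.Icc 1 (f k'), partWeight u f n k' j) *
      ∏ j ∈ Finset.Icc 1 i, partWeight u f n k j)

theorem partWeight_congr (h : ∀ k', 1 ≤ k' → k' < k → n k' = n' k') {j : ℕ} (hj1 : 1 ≤ j)
    (hj : ∀ l, l ≤ j → n k l = n' k l) : partWeight u f n k j = partWeight u f n' k j := by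
  unfold partWeight
  have h1 : ∑ l ∈ Finset.Ico 1 j, n k l = ∑ l ∈ Finset.Ico 1 j, n' k l :=
    Finset.sum_congr rfl fun l hl => hj l (Finset.mem_Ico.1 hl).2.le
  have h2 : part u f n k (j - 1) = part u f n' k (j - 1) := by
    unfold part
    rw [bounds_congr h, hj (j - 1) (by omega)]
  rw [h1, h2, hj j le_rfl, wBound, wBound, bounds_congr h]

open PowerSeries in
theorem IsPrefix.dvd_prefixWeight (h : IsPrefix u f k i n) (hu : 1 ≤ u) (j : ℕ) :
    X ^ n 1 j ∣ prefixWeight u f k i n := by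
  by_cases hn : n 1 j = 0
  · simp [hn]
  obtain ⟨-, h2, h3, h4, h5⟩ := h.support 1 j hn
  have h6 : X ^ n 1 j ∣ partWeight u f n 1 j := by
    refine Dvd.dvd.mul_right (pow_dvd_pow _ ?_) _
    rw [partExp, if_pos hu]
    exact Nat.le_self_pow two_ne_zero _
  refine Dvd.dvd.mul_left ?_ _
  rcases eq_or_lt_of_le h2 with rfl | hk
  · exact Dvd.dvd.mul_left (h6.trans (Finset.dvd_prod_of_mem _
      (Finset.mem_Icc.2 ⟨h3, h5 rfl⟩))) _
  · exact Dvd.dvd.mul_right ((h6.trans (Finset.dvd_prod_of_mem _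
      (Finset.mem_Icc.2 ⟨h3, h4⟩))).trans (Finset.dvd_prod_of_mem
      (fun k' => ∏ j ∈ Finset.Icc 1 (f k'), partWeight u f n k' j)
      (Finset.mem_Ico.2 ⟨le_rfl, hk⟩))) _

-- The weight is divisible by X^{n_{1,j}} for each j, so modulo X^N only prefixes with a bounded
-- first partition matter. Their other entries are bounded too, which leaves finitely many.
open PowerSeries in
theorem summable_prefix (hu : 1 ≤ u) (hf : 1 ≤ f 1) (k i : ℕ) {g : (ℕ → ℕ → ℕ) → ℤ⟦X⟧}
    (hg : ∀ n, ¬ IsPrefix u f k i n → g n = 0)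
    (hg' : ∀ n, IsPrefix u f k i n → prefixWeight u f k i n ∣ g n) : Summable g := by
  refine summable_of_finite_not_dvd fun N => ?_
  refine (finite_arrays k (∑ k' ∈ Finset.range (k + 1), f k') (N + k)).subset fun n hn => ?_
  have hp : IsPrefix u f k i n := by
    by_contra hp
    exact hn (by rw [hg n hp]; exact dvd_zero _)
  have hN : ∀ j, n 1 j ≤ N := by
    intro j
    by_contra hj
    exact hn (((pow_dvd_pow _ (by omega)).trans (hp.dvd_prefixWeight hu j)).trans (hg' n hp))
  have hsupp : ∀ k' j, n k' j ≠ 0 → k' ≤ k ∧ j ≤ ∑ k' ∈ Finset.range (k + 1), f k' := by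
    intro k' j hn
    obtain ⟨-, h2, -, h4, -⟩ := hp.support k' j hn
    exact ⟨h2, h4.trans (Finset.single_le_sum (f := f) (fun _ _ => Nat.zero_le _)
      (Finset.mem_range.2 (Nat.lt_succ_of_le h2)))⟩
  refine ⟨fun k' j => ?_, hsupp⟩
  by_cases hn : n k' j = 0
  · omega
  · exact (hp.apply_le hf hN k' j).trans (by have := (hsupp k' j hn).1; omega)

end

/-! ### Adding one part to a prefix -/

section

variable {t u : ℕ} {f : ℕ → ℕ} {n n' : ℕ → ℕ → ℕ} {k i v : ℕ}

/-- The array `n` with the entry `(k, j)` replaced by `v`. -/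
def setEntry (n : ℕ → ℕ → ℕ) (k j v : ℕ) : ℕ → ℕ → ℕ :=
  Function.update n k (Function.update (n k) j v)

theorem setEntry_of_ne {j k' : ℕ} (h : k' ≠ k) : setEntry n k j v k' = n k' :=
  Function.update_of_ne h _ _

theorem setEntry_self {j : ℕ} : setEntry n k j v k j = v := by simp [setEntry]

theorem setEntry_of_ne' {j l : ℕ} (h : l ≠ j) : setEntry n k j v k l = n k l := by
  simp [setEntry, h]

theorem bounds_setEntry {j k' : ℕ} (h : k' ≤ k) :
    bounds u f (setEntry n k j v) k' = bounds u f n k' :=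
  bounds_congr fun _ _ h' => setEntry_of_ne (by omega)

theorem part_setEntry {j k' l : ℕ} (h : k' ≤ k) (h' : k' = k → l ≠ j) :
    part u f (setEntry n k j v) k' l = part u f n k' l := by
  unfold part
  rw [bounds_setEntry h]
  rcases eq_or_ne k' k with rfl | hk
  · rw [setEntry_of_ne' (h' rfl)]
  · rw [setEntry_of_ne hk]

theorem wt_setEntry_of_ne {j k' : ℕ} (h : k' ≠ k) : wt f (setEntry n k j v) k' = wt f n k' := by
  simp only [wt, setEntry_of_ne h]

theorem wt_setEntry {j : ℕ} (h1 : 1 ≤ j) (h2 : j ≤ f k) (h0 : n k j = 0) :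
    wt f (setEntry n k j v) k = wt f n k + v := by
  have : ∀ l, setEntry n k j v k l = n k l + if l = j then v else 0 := by
    intro l
    rcases eq_or_ne l j with rfl | hl
    · simp [setEntry_self, h0]
    · simp [setEntry_of_ne' hl, hl]
  simp [wt, this, Finset.sum_add_distrib, h1, h2]

/-- The two conditions on v are exactly the range of summation in `stepTerm`, with L the remaining
weight and M the preceding part. -/
theorem isPrefix_setEntry (hk : 1 ≤ k) (hi : i < f k) (h0 : n k (i + 1) = 0) :
    IsPrefix u f k (i + 1) (setEntry n k (i + 1) v) ↔ IsPrefix u f k i n ∧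
      (v : ℕ∞) ≤ wBound u f n k - (wt f n k : ℕ∞) ∧ (v : ℕ∞) ≤ part u f n k i := by
  have hw := wt_setEntry (v := v) (f := f) (by omega) (Nat.succ_le_of_lt hi) h0
  have hwB : ∀ k' ≤ k, wBound u f (setEntry n k (i + 1) v) k' = wBound u f n k' :=
    fun k' hk' => by rw [wBound, wBound, bounds_setEntry hk']
  have hpv : part u f (setEntry n k (i + 1) v) k (i + 1) = v := by
    rw [part_of_pos (by omega), setEntry_self]
  constructor
  · intro h
    have hwk := h.wt_le k hk le_rfl
    rw [hw, hwB k le_rfl, Nat.cast_add] at hwk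
    refine ⟨⟨fun k' j hn => ?_, fun k' h1 h2 j h3 h4 => ?_, fun k' h1 h2 => ?_, fun h1 => ?_,
      fun k' h1 h2 => ?_⟩, ?_, ?_⟩
    · have hne : k' = k → j ≠ i + 1 := by
        rintro rfl rfl
        exact hn h0
      have hn' : setEntry n k (i + 1) v k' j ≠ 0 := by
        rcases eq_or_ne k' k with rfl | hk'
        · rwa [setEntry_of_ne' (hne rfl)]
        · rwa [setEntry_of_ne hk']
      obtain ⟨a1, a2, a3, a4, a5⟩ := h.support k' j hn'
      refine ⟨a1, a2, a3, a4, fun hk' => ?_⟩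
      have := a5 hk'
      have := hne hk'
      omega
    · by_cases hc : k' = k ∧ i + 1 ≤ j
      · obtain ⟨rfl, hc⟩ := hc
        have : n k' j = 0 := by
          rcases eq_or_lt_of_le hc with rfl | hc
          · exact h0
          · have := h.eq_zero hc
            rwa [setEntry_of_ne' (by omega)] at this
        rw [part_of_pos h3, this]
        simp
      · have := h.antitone k' h1 h2 j h3 h4
        rwa [part_setEntry h2 (by omega), part_setEntry h2 (by omega)] at this
    · rcases eq_or_ne k' k with rfl | hk'
      · exact le_self_add.trans hwk
      · have := h.wt_le k' h1 h2
        rwa [wt_setEntry_of_ne hk', hwB k' h2] at this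
    · have := h.wt_lt h1
      rwa [wt_setEntry_of_ne (by omega), hwB _ h1.le] at this
    · have := h.pos k' h1 h2
      rwa [part_setEntry h2.le (by omega)] at this
    · exact ENat.le_sub_of_add_le_left (ENat.natCast_ne_top _) hwk
    · have := h.antitone k hk le_rfl (i + 1) (by omega) hi
      rwa [hpv, Nat.add_sub_cancel, part_setEntry le_rfl (by omega)] at this
  · rintro ⟨h, hv, hv'⟩
    refine ⟨fun k' j hn => ?_, fun k' h1 h2 j h3 h4 => ?_, fun k' h1 h2 => ?_, fun h1 => ?_,
      fun k' h1 h2 => ?_⟩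
    · by_cases hc : k' = k ∧ j = i + 1
      · obtain ⟨rfl, rfl⟩ := hc
        exact ⟨hk, le_rfl, by omega, hi, fun _ => le_rfl⟩
      · have hn' : n k' j ≠ 0 := by
          rcases eq_or_ne k' k with rfl | hk'
          · rwa [setEntry_of_ne' (by omega)] at hn
          · rwa [setEntry_of_ne hk'] at hn
        obtain ⟨a1, a2, a3, a4, a5⟩ := h.support k' j hn'
        exact ⟨a1, a2, a3, a4, fun hk' => (a5 hk').trans (by omega)⟩
    · by_cases hc : k' = k ∧ i + 1 ≤ j
      · obtain ⟨rfl, hc⟩ := hc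
        rcases eq_or_lt_of_le hc with rfl | hc
        · rwa [hpv, Nat.add_sub_cancel, part_setEntry le_rfl (by omega)]
        · rw [part_of_pos h3, setEntry_of_ne' (by omega), h.eq_zero (by omega)]
          simp
      · have := h.antitone k' h1 h2 j h3 h4
        rwa [part_setEntry h2 (by omega), part_setEntry h2 (by omega)]
    · rw [hwB k' h2]
      rcases eq_or_ne k' k with rfl | hk'
      · rw [hw, Nat.cast_add]
        have := add_le_add_right hv (wt f n k' : ℕ∞)
        rwa [add_tsub_cancel_of_le (h.wt_le k' h1 h2)] at this
      · rw [wt_setEntry_of_ne hk']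
        exact h.wt_le k' h1 h2
    · rw [wt_setEntry_of_ne (by omega), hwB _ h1.le]
      exact h.wt_lt h1
    · rw [part_setEntry h2.le (by omega)]
      exact h.pos k' h1 h2

theorem prefixWeight_setEntry (h : IsPrefix u f k i n) (hi : i < f k) :
    prefixWeight u f k (i + 1) (setEntry n k (i + 1) v) = prefixWeight u f k i n *
      (PowerSeries.X ^ partExp u k v *
        stepFactor (wBound u f n k - (wt f n k : ℕ∞)) (part u f n k i) v) := by
  have hlow : ∀ k', 1 ≤ k' → k' < k → setEntry n k (i + 1) v k' = n k' :=
    fun k' _ h' => setEntry_of_ne (by omega)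
  have hlast : partWeight u f (setEntry n k (i + 1) v) k (i + 1) =
      PowerSeries.X ^ partExp u k v *
        stepFactor (wBound u f n k - (wt f n k : ℕ∞)) (part u f n k i) v := by
    unfold partWeight
    have hsum : ∑ l ∈ Finset.Ico 1 (i + 1), setEntry n k (i + 1) v k l = wt f n k := by
      rw [h.wt_eq hi.le]
      refine Finset.sum_congr (by ext; simp) fun l hl => setEntry_of_ne' ?_
      have := (Finset.mem_Icc.1 hl).2
      omega
    rw [hsum, setEntry_self, Nat.add_sub_cancel, part_setEntry le_rfl (by omega), wBound, wBound,
      bounds_setEntry le_rfl]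
  unfold prefixWeight
  rw [Finset.prod_Icc_succ_top (by omega), hlast]
  have h1 : (if u < k then (PowerSeries.X : ℤ⟦X⟧) ^ setEntry n k (i + 1) v u (f u) else 1) =
      if u < k then PowerSeries.X ^ n u (f u) else 1 := by
    split_ifs with huk
    · rw [setEntry_of_ne (by omega)]
    · rfl
  have h2 : ∏ k' ∈ Finset.Ico 1 k, ∏ j ∈ Finset.Icc 1 (f k'),
      partWeight u f (setEntry n k (i + 1) v) k' j =
      ∏ k' ∈ Finset.Ico 1 k, ∏ j ∈ Finset.Icc 1 (f k'), partWeight u f n k' j := by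
    refine Finset.prod_congr rfl fun k' hk' => Finset.prod_congr rfl fun j hj => ?_
    rw [Finset.mem_Ico] at hk'
    exact partWeight_congr (fun k'' h1 h2 => hlow k'' h1 (by omega)) (Finset.mem_Icc.1 hj).1
      fun l _ => by rw [hlow k' hk'.1 hk'.2]
  have h3 : ∏ j ∈ Finset.Icc 1 i, partWeight u f (setEntry n k (i + 1) v) k j =
      ∏ j ∈ Finset.Icc 1 i, partWeight u f n k j := by
    refine Finset.prod_congr rfl fun j hj => ?_
    rw [Finset.mem_Icc] at hj
    exact partWeight_congr hlow hj.1 fun l hl => setEntry_of_ne' (by omega)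
  rw [h1, h2, h3]
  ring

open Classical in
/-- The contribution of a prefix: its weight times the value of the sum over its completions. -/
def prefixValue (u : ℕ) (f : ℕ → ℕ) (Φ : ℕ → ℕ → ℕ → ℕ → ℤ⟦X⟧) (k i : ℕ)
    (n : ℕ → ℕ → ℕ) : ℤ⟦X⟧ :=
  if IsPrefix u f k i n then
    prefixWeight u f k i n *
      extend (Φ k i) (wBound u f n k - (wt f n k : ℕ∞)) (part u f n k i)
  else 0

theorem summable_prefixValue (hu : 1 ≤ u) (hf : 1 ≤ f 1) (Φ : ℕ → ℕ → ℕ → ℕ → ℤ⟦X⟧) (k i : ℕ) :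
    Summable (prefixValue u f Φ k i) :=
  summable_prefix hu hf k i (fun n hn => by simp [prefixValue, hn])
    fun n hn => by
      rw [prefixValue, if_pos hn]
      exact dvd_mul_right _ _

theorem le_partExp_add_one (u k m : ℕ) : m ≤ partExp u k m + 1 := by
  unfold partExp
  split_ifs
  · nlinarith
  · rcases m with _ | _ | m
    · simp
    · simp
    · simp only [Nat.add_sub_cancel]
      nlinarith

/-- Erasing the new part maps longer prefixes to shorter ones, and the Burge step evaluates the sum
over each fibre. -/
theorem hasSum_prefixValue_succ {Φ : ℕ → ℕ → ℕ → ℕ → ℤ⟦X⟧} {S : ℤ⟦X⟧} (hu : 1 ≤ u) (hf : 1 ≤ f 1)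
    (hk : 1 ≤ k) (hi : i < f k) (hstep : IsBurgeStep (partExp u k) (Φ k i) (Φ k (i + 1)))
    (hlim : HasLimits (Φ k (i + 1))) (h : HasSum (prefixValue u f Φ k i) S) :
    HasSum (prefixValue u f Φ k (i + 1)) S := by
  refine hasSum_of_hasSum_fiber (fun n => setEntry n k (i + 1) 0)
    (summable_prefixValue hu hf Φ k (i + 1)) h fun n => ?_
  by_cases h0 : n k (i + 1) = 0
  -- The fibre is parametrized by the value of the new part.
  · let e : ℕ ≃ {m // setEntry m k (i + 1) 0 = n} :=
      { toFun := fun v => ⟨setEntry n k (i + 1) v, by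
          funext k' j
          rcases eq_or_ne k' k with rfl | hk'
          · rcases eq_or_ne j (i + 1) with rfl | hj
            · rw [setEntry_self, h0]
            · rw [setEntry_of_ne' hj, setEntry_of_ne' hj]
          · rw [setEntry_of_ne hk', setEntry_of_ne hk']⟩
        invFun := fun m => m.1 k (i + 1)
        left_inv := fun v => setEntry_self
        right_inv := by
          rintro ⟨m, rfl⟩
          apply Subtype.ext
          funext k' j
          dsimp only
          rcases eq_or_ne k' k with rfl | hk'
          · rcases eq_or_ne j (i + 1) with rfl | hj
            · rw [setEntry_self]
            · rw [setEntry_of_ne' hj, setEntry_of_ne' hj]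
          · rw [setEntry_of_ne hk', setEntry_of_ne hk'] }
    rw [← e.hasSum_iff]
    change HasSum (fun v => prefixValue u f Φ k (i + 1) (setEntry n k (i + 1) v)) _
    by_cases hp : IsPrefix u f k i n
    · have hs := (hstep.hasSum (le_partExp_add_one u k) hlim
        (wBound u f n k - (wt f n k : ℕ∞)) (part u f n k i)).mul_left (prefixWeight u f k i n)
      rw [show prefixValue u f Φ k i n = _ from if_pos hp]
      rw [show (fun v => prefixValue u f Φ k (i + 1) (setEntry n k (i + 1) v)) = _ from
        funext fun v => ?_]
      · exact hs
      unfold prefixValue stepTerm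
      rw [isPrefix_setEntry hk hi h0]
      by_cases hc : (v : ℕ∞) ≤ wBound u f n k - (wt f n k : ℕ∞) ∧ (v : ℕ∞) ≤ part u f n k i
      · rw [if_pos ⟨hp, hc⟩, if_pos hc, prefixWeight_setEntry hp hi,
          wt_setEntry (by omega) hi h0, part_of_pos (i := i + 1) (by omega), setEntry_self, wBound,
          wBound, bounds_setEntry le_rfl, Nat.cast_add, tsub_tsub, mul_assoc (prefixWeight u f k i n)]
      · rw [if_neg (fun h => hc h.2), if_neg hc, mul_zero]
    · have hz : ∀ v, prefixValue u f Φ k (i + 1) (setEntry n k (i + 1) v) = 0 := fun v =>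
        if_neg fun h => hp ((isPrefix_setEntry hk hi h0).1 h).1
      simp only [hz, show prefixValue u f Φ k i n = 0 from if_neg hp]
      exact hasSum_zero
  · have hp : ¬ IsPrefix u f k i n := fun h => h0 (h.eq_zero (Nat.lt_succ_self i))
    have : IsEmpty {m // setEntry m k (i + 1) 0 = n} :=
      ⟨fun m => h0 (by rw [← m.2, setEntry_self])⟩
    rw [show prefixValue u f Φ k i n = 0 from if_neg hp]
    exact hasSum_empty

theorem hasSum_prefixValue_row {Φ : ℕ → ℕ → ℕ → ℕ → ℤ⟦X⟧} {S : ℤ⟦X⟧} (hu : 1 ≤ u) (hf : 1 ≤ f 1)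
    (hk : 1 ≤ k) (hstep : ∀ i < f k, IsBurgeStep (partExp u k) (Φ k i) (Φ k (i + 1)))
    (hlim : ∀ i < f k, HasLimits (Φ k (i + 1))) (h : HasSum (prefixValue u f Φ k 0) S) :
    HasSum (prefixValue u f Φ k (f k)) S := by
  have : ∀ i ≤ f k, HasSum (prefixValue u f Φ k i) S := by
    intro i
    induction i with
    | zero => exact fun _ => h
    | succ i ih =>
      exact fun hi => hasSum_prefixValue_succ hu hf hk hi (hstep i hi) (hlim i hi) (ih (by omega))
  exact this _ le_rfl

end

/-! ### Passing to the next partition, and the sum over complete sequences -/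

section

variable {t u : ℕ} {f : ℕ → ℕ} {n : ℕ → ℕ → ℕ} {k : ℕ}

theorem IsPrefix.wt_eq_zero (h : ∀ j, n k j = 0) : wt f n k = 0 := by simp [wt, h]

theorem isPrefix_succ_zero (hk : 1 ≤ k) : IsPrefix u f (k + 1) 0 n ↔ IsPrefix u f k (f k) n ∧
    (k = u → (wt f n u : ℕ∞) < wBound u f n u) ∧ (u < k → 0 < part u f n k (f k)) := by
  constructor
  · intro h
    refine ⟨⟨fun k' j hn => ?_, fun k' h1 h2 => h.antitone k' h1 (by omega),
      fun k' h1 h2 => h.wt_le k' h1 (by omega), fun h1 => h.wt_lt (by omega),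
      fun k' h1 h2 => h.pos k' h1 (by omega)⟩, fun h1 => h.wt_lt (by omega),
      fun h1 => h.pos k h1 (by omega)⟩
    obtain ⟨a1, a2, a3, a4, a5⟩ := h.support k' j hn
    have hk' : k' ≠ k + 1 := fun h => by have := a5 h; omega
    exact ⟨a1, by omega, a3, a4, by rintro rfl; exact a4⟩
  · rintro ⟨h, h1, h2⟩
    have hz : ∀ j, n (k + 1) j = 0 := by
      intro j
      by_contra hn
      have := (h.support _ j hn).2.1
      omega
    refine ⟨fun k' j hn => ?_, fun k' a1 a2 j a3 a4 => ?_, fun k' a1 a2 => ?_, fun a1 => ?_,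
      fun k' a1 a2 => ?_⟩
    · obtain ⟨a1, a2, a3, a4, -⟩ := h.support k' j hn
      exact ⟨a1, by omega, a3, a4, by omega⟩
    · rcases eq_or_ne k' (k + 1) with rfl | hk'
      · rw [part_of_pos a3, hz]
        simp
      · exact h.antitone k' a1 (by omega) j a3 a4
    · rcases eq_or_ne k' (k + 1) with rfl | hk'
      · rw [IsPrefix.wt_eq_zero hz]
        simp
      · exact h.wt_le k' a1 (by omega)
    · rcases eq_or_ne k u with hku | hku
      · exact h1 hku
      · exact h.wt_lt (by omega)
    · rcases eq_or_ne k' k with rfl | hk'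
      · exact h2 a1
      · exact h.pos k' a1 (by omega)

theorem prefixWeight_succ_zero (hk : 1 ≤ k) : prefixWeight u f (k + 1) 0 n =
    (if k = u then PowerSeries.X ^ n u (f u) else 1) * prefixWeight u f k (f k) n := by
  unfold prefixWeight
  rw [Finset.prod_Ico_succ_top hk]
  rcases lt_trichotomy u k with h | rfl | h
  · simp [h, h.ne', show u < k + 1 by omega]
  · simp
  · simp [h.ne, show ¬ u < k + 1 by omega, show ¬ u < k by omega]

open Classical in
/-- The summand of a complete sequence of partitions, extended by zero. -/
def completeTerm (t u : ℕ) (f : ℕ → ℕ) (x : ℕ) (n : ℕ → ℕ → ℕ) : ℤ⟦X⟧ :=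
  if IsAdmissible t u f x n then prefixWeight u f x (f x) n else 0

/-- The functions `Φ k i` satisfy the relations obeyed by the sums over the completions of a
prefix that ends with the `i`-th part of the `k`-th partition. -/
structure IsBurgeChain (t u : ℕ) (f : ℕ → ℕ) (Φ : ℕ → ℕ → ℕ → ℕ → ℤ⟦X⟧) : Prop where
  step : ∀ k, 1 ≤ k → k ≤ t + 1 → ∀ i < f k,
    IsBurgeStep (partExp u k) (Φ k i) (Φ k (i + 1))
  limits : ∀ k, 1 ≤ k → k ≤ t + 1 → ∀ i < f k, HasLimits (Φ k (i + 1))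
  swap : ∀ k, 1 ≤ k → k < u → ∀ L M, extend (Φ k (f k)) L M = extend (Φ (k + 1) 0) M L
  turn : ∀ (L : ℕ∞) (M : ℕ), extend (Φ u (f u)) L M =
    if L = 0 then (if M = 0 then 1 else 0)
    else PowerSeries.X ^ M * extend (Φ (u + 1) 0) (L - 1) (M + 1)
  swap_shift : ∀ k, u < k → k ≤ t → ∀ L M : ℕ∞, L ≠ ⊤ ∨ M ≠ ⊤ → extend (Φ k (f k)) L M =
    if M = 0 then (if L = 0 then 1 else 0) else extend (Φ (k + 1) 0) (M - 1) (L + 1)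
  last : ∀ L M : ℕ∞, L ≠ ⊤ ∨ M ≠ ⊤ →
    extend (Φ (t + 1) (f (t + 1))) L M = if L = 0 then 1 else 0

theorem IsPrefix.tsub_eq_zero_iff {i : ℕ} (h : IsPrefix u f k i n) (hk : 1 ≤ k) :
    wBound u f n k - (wt f n k : ℕ∞) = 0 ↔ (wt f n k : ℕ∞) = wBound u f n k := by
  rw [tsub_eq_zero_iff_le]
  exact ⟨fun h' => le_antisymm (h.wt_le k hk le_rfl) h', fun h' => h'.ge⟩

theorem enat_sub_add_one {w : ℕ∞} {a : ℕ} (h : (a : ℕ∞) ≤ w) : w - a + 1 = w + 1 - a := by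
  induction w using ENat.recTopCoe with
  | top => simp
  | coe w =>
    have : a ≤ w := by exact_mod_cast h
    exact_mod_cast (by omega : w - a + 1 = w + 1 - a)

/-- At the end of a row a prefix stops or continues, never both. Before row u it must continue. In
row u it stops if the weight is exhausted and the last part is zero, and continues if weight
remains. In later rows it continues exactly when the last part is positive, and otherwise must have
exhausted its weight. -/
theorem IsBurgeChain.prefixValue_eq {Φ : ℕ → ℕ → ℕ → ℕ → ℤ⟦X⟧} (h : IsBurgeChain t u f Φ)
    (hu : 1 ≤ u) (hut : u ≤ t) (hf : 1 ≤ f 1) (hfu : 1 ≤ f u) (hk : 1 ≤ k) (hkt : k ≤ t) :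
    prefixValue u f Φ k (f k) n = completeTerm t u f k n + prefixValue u f Φ (k + 1) 0 n := by
  classical
  by_cases hp : IsPrefix u f k (f k) n
  swap
  · rw [prefixValue, completeTerm, prefixValue, if_neg hp,
      if_neg fun h' => hp (isAdmissible_iff.1 h').2.1,
      if_neg fun h' => hp ((isPrefix_succ_zero hk).1 h').1, add_zero]
  have hz : wt f n (k + 1) = 0 := IsPrefix.wt_eq_zero fun j => by
    by_contra hn
    have := (hp.support _ j hn).2.1
    omega
  have hL := hp.tsub_eq_zero_iff hk
  have hw : wBound u f n (k + 1) = (bounds u f n (k + 1)).2 := rfl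
  rw [prefixValue, completeTerm, prefixValue, if_pos hp, isAdmissible_iff,
    isPrefix_succ_zero hk, prefixWeight_succ_zero hk, hz, hw, part_zero,
    bounds_succ hk, Nat.cast_zero, tsub_zero]
  rcases lt_trichotomy k u with hku | rfl | hku
  · rw [if_neg (fun h' => by omega), if_pos ⟨hp, fun h' => by omega, fun h' => by omega⟩,
      if_neg hku.ne, if_pos hku, h.swap k hk hku, zero_add, one_mul]
  · rw [if_neg (lt_irrefl k), if_pos rfl, if_pos rfl, part_of_pos hfu, h.turn]
    dsimp only
    by_cases h0 : wBound k f n k - (wt f n k : ℕ∞) = 0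
    · rw [if_pos h0]
      have h1 := hL.1 h0
      rw [if_neg (c := IsPrefix k f k (f k) n ∧ _) fun h' => by
        have := h'.2.1 rfl
        rw [h1] at this
        exact lt_irrefl _ this]
      by_cases hM : n k (f k) = 0
      · rw [if_pos hM, if_pos ⟨⟨le_rfl, by omega⟩, hp, h1, fun _ => by simpa using hM⟩]
        simp
      · rw [if_neg hM, if_neg fun h' => hM (by simpa using h'.2.2.2 (by omega))]
        simp
    · have h1 : ¬ (wt f n k : ℕ∞) = wBound k f n k := fun h' => h0 (hL.2 h')
      rw [if_neg h0, if_neg fun h' => h1 h'.2.2.1,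
        if_pos ⟨hp, fun _ => lt_of_le_of_ne (hp.wt_le k hk le_rfl) h1, fun h' => by omega⟩,
        tsub_right_comm]
      ring
  · have hdom := hp.ne_top hf (by omega) le_rfl (wt f n k)
    rw [if_neg (show ¬ k < u by omega), if_neg (show ¬ k = u by omega), if_neg hku.ne',
      h.swap_shift k hku hkt _ _ hdom]
    dsimp only
    by_cases hM : part u f n k (f k) = 0
    · rw [if_pos hM, if_neg (c := IsPrefix u f k (f k) n ∧ _) fun h' => by
        have := h'.2.2 hku
        rw [hM] at this
        exact lt_irrefl _ this]
      by_cases h0 : wBound u f n k - (wt f n k : ℕ∞) = 0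
      · rw [if_pos h0, if_pos ⟨⟨hku.le, by omega⟩, hp, hL.1 h0, fun _ => hM⟩]
        simp
      · rw [if_neg h0, if_neg fun h' => h0 (hL.2 h'.2.2.1)]
        simp
    · rw [if_neg hM, if_neg fun h' => hM (h'.2.2.2 (by omega)),
        if_pos ⟨hp, fun h' => by omega, fun _ => pos_iff_ne_zero.2 hM⟩, zero_add, one_mul,
        enat_sub_add_one (hp.wt_le k hk le_rfl)]

theorem IsBurgeChain.prefixValue_last {Φ : ℕ → ℕ → ℕ → ℕ → ℤ⟦X⟧} (h : IsBurgeChain t u f Φ)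
    (hut : u ≤ t) (ht : 1 ≤ t) (hf : 1 ≤ f 1) :
    prefixValue u f Φ (t + 1) (f (t + 1)) n = completeTerm t u f (t + 1) n := by
  classical
  by_cases hp : IsPrefix u f (t + 1) (f (t + 1)) n
  · have hdom := hp.ne_top hf (by omega) le_rfl (wt f n (t + 1))
    have hL := hp.tsub_eq_zero_iff (by omega)
    rw [prefixValue, completeTerm, if_pos hp, isAdmissible_iff, h.last _ _ hdom]
    by_cases h0 : wBound u f n (t + 1) - (wt f n (t + 1) : ℕ∞) = 0
    · rw [if_pos h0, if_pos ⟨⟨by omega, le_rfl⟩, hp, hL.1 h0, fun h' => by omega⟩, mul_one]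
    · rw [if_neg h0, if_neg fun h' => h0 (hL.2 h'.2.2.1), mul_zero]
  · rw [prefixValue, completeTerm, if_neg hp, if_neg fun h' => hp (isAdmissible_iff.1 h').2.1]

theorem summable_completeTerm (hu : 1 ≤ u) (hf : 1 ≤ f 1) (x : ℕ) :
    Summable (completeTerm t u f x) := by
  classical
  refine summable_prefix hu hf x (f x) (fun n hn => ?_) fun n _ => ?_
  · exact if_neg fun h' => hn (isAdmissible_iff.1 h').2.1
  · unfold completeTerm
    split_ifs
    · exact dvd_rfl
    · exact dvd_zero _

theorem hasSum_prefixValue_start (Φ : ℕ → ℕ → ℕ → ℕ → ℤ⟦X⟧) (hu : 1 ≤ u) :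
    HasSum (prefixValue u f Φ 1 0) (extend (Φ 1 0) ⊤ ⊤) := by
  have hp : IsPrefix u f 1 0 (fun _ _ => 0) :=
    ⟨fun _ _ h => absurd rfl h, fun _ _ _ _ h3 _ => by rw [part_of_pos h3]; simp,
      fun _ _ _ => by simp [wt], fun h => by omega, fun _ _ _ => by omega⟩
  have hv : prefixValue u f Φ 1 0 (fun _ _ => 0) = extend (Φ 1 0) ⊤ ⊤ := by
    rw [prefixValue, if_pos hp]
    simp [prefixWeight, wBound, part_zero, bounds, wt, show ¬ u < 1 by omega]
  rw [← hv]
  refine hasSum_single _ fun n hn => if_neg fun h => hn ?_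
  funext k j
  by_contra h0
  obtain ⟨h1, h2, h3, -, h5⟩ := h.support k j h0
  have := h5 (by omega)
  omega

/-- The sum over all complete sequences is the value of the chain at its root. -/
theorem IsBurgeChain.hasSum {Φ : ℕ → ℕ → ℕ → ℕ → ℤ⟦X⟧} (h : IsBurgeChain t u f Φ)
    (hu : 1 ≤ u) (hut : u ≤ t) (hf : 1 ≤ f 1) (hfu : 1 ≤ f u) :
    HasSum (fun σ : AdmissibleSeq t u f => prefixWeight u f σ.1.1 (f σ.1.1) σ.1.2)
      (extend (Φ 1 0) ⊤ ⊤) := by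
  classical
  set S := extend (Φ 1 0) ⊤ ⊤ with hS
  set D : ℕ → ℤ⟦X⟧ := fun x => ∑' n, completeTerm t u f x n with hD
  have hDs : ∀ x, HasSum (completeTerm t u f x) (D x) :=
    fun x => (summable_completeTerm hu hf x).hasSum
  -- The prefixes surviving to the end of row k carry the total less what was contributed by
  -- sequences that stopped earlier.
  have key : ∀ k, 1 ≤ k → k ≤ t + 1 →
      HasSum (prefixValue u f Φ k (f k)) (S - ∑ x ∈ Finset.Ico 1 k, D x) := by
    intro k hk
    induction k, hk using Nat.le_induction with
    | base =>
      intro _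
      refine hasSum_prefixValue_row hu hf le_rfl (h.step 1 le_rfl (by omega))
        (h.limits 1 le_rfl (by omega)) ?_
      simpa using hasSum_prefixValue_start Φ hu
    | succ k hk ih =>
      intro hkt
      refine hasSum_prefixValue_row hu hf (by omega) (h.step _ (by omega) hkt)
        (h.limits _ (by omega) hkt) ?_
      have := (ih (by omega)).sub (hDs k)
      rw [Finset.sum_Ico_succ_top hk, ← sub_sub]
      refine this.congr_fun fun n => ?_
      rw [h.prefixValue_eq hu hut hf hfu hk (by omega), add_sub_cancel_left]
  have hlast := (key (t + 1) (by omega) le_rfl).unique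
    (by simpa only [← funext fun n => h.prefixValue_last (n := n) hut (by omega) hf] using hDs (t + 1))
  have htot : S = ∑ x ∈ Finset.Ico 1 (t + 2), D x := by
    rw [Finset.sum_Ico_succ_top (by omega), ← hlast]
    ring
  have hinj : ∀ x : ℕ, Function.Injective fun n : ℕ → ℕ → ℕ => (x, n) :=
    fun x _ _ hab => (Prod.mk.inj hab).2
  have hx : ∀ x, HasSum (fun σ : ℕ × (ℕ → ℕ → ℕ) =>
      if σ.1 = x then completeTerm t u f x σ.2 else 0) (D x) := by
    intro x
    rw [← (hinj x).hasSum_iff]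
    · simpa [Function.comp_def] using hDs x
    · rintro ⟨y, n⟩ hy
      refine if_neg ?_
      rintro rfl
      exact hy ⟨n, rfl⟩
  have hall := hasSum_sum (s := Finset.Ico 1 (t + 2)) fun x _ => hx x
  rw [← htot] at hall
  have hsub : HasSum ((fun σ : ℕ × (ℕ → ℕ → ℕ) => completeTerm t u f σ.1 σ.2) ∘
      (Subtype.val : AdmissibleSeq t u f → _)) S := by
    refine (Subtype.val_injective.hasSum_iff ?_).2 ?_
    · intro σ hσ
      refine if_neg fun hA => hσ ⟨⟨σ, hA⟩, rfl⟩
    · convert hall using 2 with σ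
      rw [Finset.sum_ite_eq]
      split_ifs with hm
      · rfl
      · refine if_neg fun hA => hm ?_
        have h1 := hA.u_le
        have h2 := hA.le_t
        rw [Finset.mem_Ico]
        omega
  refine hsub.congr_fun fun σ => ?_
  exact (if_pos σ.2).symm

end

/-! ### Continued fractions and the chain of bosonic polynomials -/

section

/-- The pair of which the list is a continued fraction. -/
def cfVal : List ℕ → ℕ × ℕ
  | [] => (1, 0)
  | c :: l => (c * (cfVal l).1 + (cfVal l).2, (cfVal l).1)

theorem cfVal_euclidSeq {s r : ℕ} (h0 : 0 < s) (h : Nat.Coprime s r) :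
    cfVal (euclidSeq s r) = (s, r) := by
  induction r using Nat.strong_induction_on generalizing s with
  | _ r ih =>
    rw [euclidSeq]
    split_ifs with hr
    · subst hr
      rw [Nat.coprime_zero_right] at h
      simp [cfVal, h]
    · have hlt := Nat.mod_lt s (Nat.pos_of_ne_zero hr)
      have hc : Nat.Coprime r (s % r) := by
        rw [Nat.coprime_comm, Nat.Coprime, ← Nat.gcd_rec]
        exact h.symm
      rw [cfVal, ih _ hlt (Nat.pos_of_ne_zero hr) hc]
      simp only [Prod.mk.injEq, and_true]
      rw [mul_comm]
      exact Nat.div_add_mod s r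

theorem cfVal_append_one (l : List ℕ) (a : ℕ) : cfVal (l ++ [a, 1]) = cfVal (l ++ [a + 1]) := by
  induction l with
  | nil => simp [cfVal]
  | cons b l ih => simp only [List.cons_append, cfVal, ih]

theorem IsContFrac.cfVal_eq {l : List ℕ} {s r : ℕ} (h : IsContFrac l s r) : cfVal l = (s, r) := by
  obtain ⟨h0, hc, rfl | ⟨l', a, rfl, ha⟩⟩ := h
  · exact cfVal_euclidSeq h0 hc
  · rw [cfVal_append_one, ← ha]
    exact cfVal_euclidSeq h0 hc

theorem pos_of_mem_euclidSeq {s r : ℕ} (h : r ≤ s) : ∀ x ∈ euclidSeq s r, 0 < x := by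
  induction r using Nat.strong_induction_on generalizing s with
  | _ r ih =>
    intro x hx
    rw [euclidSeq] at hx
    split_ifs at hx with hr
    · simp at hx
    · have hlt := Nat.mod_lt s (Nat.pos_of_ne_zero hr)
      rw [List.mem_cons] at hx
      rcases hx with rfl | hx
      · exact Nat.div_pos h (Nat.pos_of_ne_zero hr)
      · exact ih _ hlt hlt.le x hx

theorem IsContFrac.coeff_pos {c : ℕ → ℕ} {t p p' : ℕ} (hpp' : p < p')
    (hc : IsContFrac ((List.range' 1 (t - 1)).map c ++ [c t + 2]) p' p) {k : ℕ} (h1 : 1 ≤ k)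
    (h2 : k < t) : 1 ≤ c k := by
  have hmem : c k ∈ (List.range' 1 (t - 1)).map c ++ [c t + 2] := by
    refine List.mem_append_left _ (List.mem_map.2 ⟨k, ?_, rfl⟩)
    rw [List.mem_range'_1]
    omega
  obtain ⟨-, -, h | ⟨l', a, h, -⟩⟩ := hc
  · rw [← h] at hmem
    exact pos_of_mem_euclidSeq hpp'.le _ hmem
  -- The alternative form would end in 1, whereas the last entry is c_t + 2.
  · have := congrArg List.getLast? h
    simp at this

/-- The successive remainders of a continued fraction. -/
structure IsRemainderSeq (c : ℕ → ℕ) (t m : ℕ) (P : ℕ → ℤ) : Prop where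
  rec_eq : ∀ k, 1 ≤ k → k < t → P k = c k * P (k + 1) + P (k + 2)
  at_end : P t = m
  after_end : P (t + 1) = 1

theorem exists_isRemainderSeq (c : ℕ → ℕ) {t : ℕ} (ht : 1 ≤ t) (m : ℕ) :
    ∃ P : ℕ → ℤ, IsRemainderSeq c t m P ∧
      P 1 = (cfVal ((List.range' 1 (t - 1)).map c ++ [m])).1 ∧
      P 2 = (cfVal ((List.range' 1 (t - 1)).map c ++ [m])).2 := by
  let Q : ℕ → ℕ × ℕ := fun k => cfVal ((List.range' k (t - k)).map c ++ [m])
  -- The value 1 beyond t is the denominator of the one-term tail (m : 1).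
  let P : ℕ → ℤ := fun k => if k ≤ t then ((Q k).1 : ℤ) else 1
  have hQ : ∀ k, k < t → Q k = (c k * (Q (k + 1)).1 + (Q (k + 1)).2, (Q (k + 1)).1) := by
    intro k hk
    simp only [Q]
    rw [show t - k = (t - (k + 1)) + 1 by omega, List.range'_succ]
    rfl
  have hQt : Q t = (m, 1) := by simp [Q, cfVal]
  have hP : ∀ k, k ≤ t → P k = (Q k).1 := fun k hk => by simp [P, hk]
  have hPt : P (t + 1) = 1 := by simp [P]
  have hP' : ∀ k, k ≤ t → P (k + 1) = (Q k).2 := by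
    intro k hk
    rcases eq_or_lt_of_le hk with rfl | hk
    · rw [hPt, hQt]; rfl
    · rw [hP _ hk, hQ k hk]
  refine ⟨P, ⟨fun k _ hk => ?_, ?_, hPt⟩, hP 1 ht, hP' 1 ht⟩
  · rw [hP k hk.le, hP (k + 1) hk, hP' (k + 1) hk, hQ k hk]
    push_cast
    rfl
  · rw [hP t le_rfl, hQt]

section

variable {c : ℕ → ℕ} {t u d m : ℕ} {P S : ℕ → ℤ}

theorem IsRemainderSeq.one_le (h : IsRemainderSeq c t m P) (hm : 1 ≤ m) {k : ℕ} (hk : 1 ≤ k)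
    (hkt : k ≤ t + 1) : 1 ≤ P k := by
  have key : ∀ j, j < t → 1 ≤ P (t - j) ∧ 1 ≤ P (t - j + 1) := by
    intro j
    induction j with
    | zero =>
      intro _
      rw [Nat.sub_zero, h.at_end, h.after_end]
      omega
    | succ j ih =>
      intro hj
      obtain ⟨h1, h2⟩ := ih (by omega)
      have := h.rec_eq (t - (j + 1)) (by omega) (by omega)
      rw [show t - (j + 1) + 1 = t - j by omega, show t - (j + 1) + 2 = t - j + 1 by omega] at this
      rw [show t - (j + 1) + 1 = t - j by omega]
      refine ⟨?_, h1⟩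
      have : 0 ≤ (c (t - (j + 1)) : ℤ) * P (t - j) := mul_nonneg (by omega) (by omega)
      omega
  rcases eq_or_lt_of_le hkt with rfl | hkt
  · rw [h.after_end]
  · have := (key (t - k) (by omega)).1
    rwa [show t - (t - k) = k by omega] at this

theorem IsRemainderSeq.mul_add_one_le (h : IsRemainderSeq c t (c t + 2) P) {k : ℕ} (hk : 1 ≤ k)
    (hkt : k ≤ t) : c k * P (k + 1) + 1 ≤ P k := by
  rcases eq_or_lt_of_le hkt with rfl | hkt
  · rw [h.after_end, h.at_end]
    push_cast
    omega
  · rw [h.rec_eq k hk hkt]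
    have := h.one_le (by omega) (show 1 ≤ k + 2 by omega) (by omega)
    omega

/-- Below u both sequences satisfy the same recursion with nonnegative coefficients, so the
comparison propagates down from indices u and u + 1. It places (r, s) in the bosonic range at every
step of the algorithm. -/
theorem IsRemainderSeq.le (h : IsRemainderSeq c t (c t + 2) P) (hS : IsRemainderSeq c u d S)
    (hut : u ≤ t) (hd : d ≤ c u) {k : ℕ} (hk : 1 ≤ k) (hku : k ≤ u + 1) :
    0 ≤ S k ∧ S k ≤ P k := by
  have hP : ∀ {k}, 1 ≤ k → k ≤ t + 1 → 1 ≤ P k := fun h1 h2 => h.one_le (by omega) h1 h2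
  have hend : 0 ≤ S (u + 1) ∧ S (u + 1) ≤ P (u + 1) := by
    rw [hS.after_end]
    exact ⟨zero_le_one, hP (by omega) (by omega)⟩
  have key : ∀ j, j < u → (0 ≤ S (u - j) ∧ S (u - j) ≤ P (u - j)) ∧
      (0 ≤ S (u - j + 1) ∧ S (u - j + 1) ≤ P (u - j + 1)) := by
    intro j
    induction j with
    | zero =>
      intro hu
      refine ⟨?_, hend⟩
      rw [Nat.sub_zero, hS.at_end]
      have h1 := h.mul_add_one_le (k := u) (by omega) hut
      have h2 := hP (k := u + 1) (by omega) (by omega)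
      have : (d : ℤ) ≤ c u := by exact_mod_cast hd
      refine ⟨by omega, ?_⟩
      nlinarith
    | succ j ih =>
      intro hj
      obtain ⟨⟨h1, h1'⟩, h2, h2'⟩ := ih (by omega)
      have e1 := h.rec_eq (u - (j + 1)) (by omega) (by omega)
      have e2 := hS.rec_eq (u - (j + 1)) (by omega) (by omega)
      rw [show u - (j + 1) + 1 = u - j by omega, show u - (j + 1) + 2 = u - j + 1 by omega]
        at e1 e2
      rw [show u - (j + 1) + 1 = u - j by omega]
      refine ⟨⟨?_, ?_⟩, h1, h1'⟩
      · rw [e2]; positivity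
      · rw [e1, e2]
        have := mul_le_mul_of_nonneg_left h1' (Int.natCast_nonneg (c (u - (j + 1))))
        omega
  rcases eq_or_lt_of_le hku with rfl | hku
  · exact hend
  · have := (key (u - k) (by omega)).1
    rwa [show u - (u - k) = k by omega] at this

theorem fSeq_of_lt {k : ℕ} (h : k < u) : fSeq c u d k = c k := by simp [fSeq, h]

theorem fSeq_self : fSeq c u d u = d := by simp [fSeq]

theorem fSeq_succ : fSeq c u d (u + 1) = c u - d := by simp [fSeq]

theorem fSeq_of_gt {k : ℕ} (h : u + 1 < k) : fSeq c u d k = c (k - 1) := by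
  simp [fSeq, show ¬ k < u by omega, show k ≠ u by omega, h.ne']

theorem bosRange_row (h : IsRemainderSeq c t (c t + 2) P) (hS : IsRemainderSeq c u d S)
    (hut : u ≤ t) (hd : d ≤ c u) {k : ℕ} (hk : 1 ≤ k) (hku : k ≤ u) {i : ℕ}
    (hi : i ≤ fSeq c u d k) :
    BosRange (P (k + 1)) (P k - i * P (k + 1)) (S (k + 1)) (S k - i * S (k + 1)) := by
  have hP := h.one_le (by omega) (show 1 ≤ k + 1 by omega) (by omega)
  have hPS := h.le hS hut hd (show 1 ≤ k + 1 by omega) (by omega)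
  have hge := h.mul_add_one_le hk (by omega)
  rcases eq_or_lt_of_le hku with rfl | hku
  · rw [fSeq_self] at hi
    rw [hS.after_end, hS.at_end] at *
    have h1 : (i : ℤ) ≤ d := by exact_mod_cast hi
    have h2 : (d : ℤ) ≤ c k := by exact_mod_cast hd
    refine ⟨hP, ?_, by omega, hPS.2, by omega, ?_⟩ <;> nlinarith
  · rw [fSeq_of_lt hku] at hi
    have hPS' := h.le hS hut hd (show 1 ≤ k + 2 by omega) (by omega)
    have e1 := h.rec_eq k hk (by omega)
    have e2 := hS.rec_eq k hk hku
    have hP2 := h.one_le (by omega) (show 1 ≤ k + 2 by omega) (by omega)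
    obtain ⟨a, ha⟩ := Nat.exists_eq_add_of_le hi
    have ea : P k - i * P (k + 1) = a * P (k + 1) + P (k + 2) := by rw [e1, ha]; push_cast; ring
    have eb : S k - i * S (k + 1) = a * S (k + 1) + S (k + 2) := by rw [e2, ha]; push_cast; ring
    rw [ea, eb]
    have h1 := mul_le_mul_of_nonneg_left hPS.2 (Int.natCast_nonneg a)
    have h2 : 0 ≤ (a : ℤ) * S (k + 1) := mul_nonneg (by omega) hPS.1
    exact ⟨hP, by omega, hPS.1, hPS.2, by omega, by omega⟩

/-- The larger parameter at the start of row `k > u`. -/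
def rowStart (P : ℕ → ℤ) (u d k : ℕ) : ℤ :=
  if k = u + 1 then P u - d * P (u + 1) else P (k - 1)

/-- The bosonic polynomials attached to the prefixes. -/
def bosChain (P S : ℕ → ℤ) (u d k i : ℕ) : ℕ → ℕ → ℤ⟦X⟧ :=
  if k ≤ u then bosFin (P (k + 1)) (P k - i * P (k + 1)) (S (k + 1)) (S k - i * S (k + 1))
  else bosShift (P k) (rowStart P u d k - i * P k)

/-- Row u + 1 performs the c_u - d subtractions left over from the u-th quotient; each later row
performs one whole quotient. -/
theorem rowStart_sub (h : IsRemainderSeq c t (c t + 2) P) (hd : d ≤ c u) (hu : 1 ≤ u) {k : ℕ}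
    (hk : u < k) (hkt : k ≤ t) :
    rowStart P u d k - fSeq c u d k * P k = P (k + 1) := by
  unfold rowStart
  split_ifs with hku
  · subst hku
    rw [fSeq_succ, h.rec_eq u hu (by omega), Nat.cast_sub hd]
    ring
  · rw [fSeq_of_gt (by omega)]
    have := h.rec_eq (k - 1) (by omega) (by omega)
    rw [show k - 1 + 1 = k by omega, show k - 1 + 2 = k + 1 by omega] at this
    rw [this]
    ring

/-- The last quotient is c_t + 2 but only c_t steps are spent on it, so the algorithm halts at the
pair (1, 2). -/
theorem rowStart_sub_last (h : IsRemainderSeq c t (c t + 2) P) (hd : d ≤ c u) (hut : u ≤ t) :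
    rowStart P u d (t + 1) - fSeq c u d (t + 1) * P (t + 1) = 2 := by
  unfold rowStart
  rw [h.after_end]
  split_ifs with hku
  · obtain rfl : t = u := by omega
    rw [fSeq_succ, h.at_end, h.after_end, Nat.cast_sub hd]
    push_cast
    ring
  · rw [fSeq_of_gt (by omega), Nat.add_sub_cancel, h.at_end]
    push_cast
    ring

theorem one_le_rowStart_sub (h : IsRemainderSeq c t (c t + 2) P) (hd : d ≤ c u) (hu : 1 ≤ u)
    (hut : u ≤ t) {k : ℕ} (hk : u < k) (hkt : k ≤ t + 1) {i : ℕ} (hi : i ≤ fSeq c u d k) :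
    1 ≤ rowStart P u d k - i * P k := by
  have hP := h.one_le (by omega) (show 1 ≤ k by omega) hkt
  have h1 : (i : ℤ) * P k ≤ fSeq c u d k * P k :=
    mul_le_mul_of_nonneg_right (by exact_mod_cast hi) (by omega)
  rcases eq_or_lt_of_le hkt with rfl | hkt
  · have := rowStart_sub_last h hd hut
    omega
  · have := rowStart_sub h hd hu hk (by omega)
    have := h.one_le (by omega) (show 1 ≤ k + 1 by omega) (by omega)
    omega

theorem isBurgeChain_bosChain (h : IsRemainderSeq c t (c t + 2) P) (hS : IsRemainderSeq c u d S)
    (hu : 1 ≤ u) (hut : u ≤ t) (hd : d ≤ c u) :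
    IsBurgeChain t u (fSeq c u d) (bosChain P S u d) where
  step k hk hkt i hi := by
    unfold bosChain
    split_ifs with hku
    · have := isBurgeStep_bosFin (bosRange_row h hS hut hd hk hku (i := i + 1) hi)
      rw [show P k - ((i + 1 : ℕ) : ℤ) * P (k + 1) + P (k + 1) = P k - i * P (k + 1) by
        push_cast; ring,
        show S k - ((i + 1 : ℕ) : ℤ) * S (k + 1) + S (k + 1) = S k - i * S (k + 1) by
        push_cast; ring] at this
      rwa [show partExp u k = fun n => n ^ 2 from funext fun n => if_pos hku]
    · have := isBurgeStep_bosShift (h.one_le (by omega) hk hkt)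
        (one_le_rowStart_sub h hd hu hut (by omega) hkt (i := i + 1) hi)
      rw [show rowStart P u d k - ((i + 1 : ℕ) : ℤ) * P k + P k = rowStart P u d k - i * P k by
        push_cast; ring] at this
      rwa [show partExp u k = fun n => n * (n - 1) from funext fun n => if_neg hku]
  limits k hk hkt i hi := by
    unfold bosChain
    split_ifs with hku
    · exact hasLimits_bosFin (bosRange_row h hS hut hd hk hku hi)
    · exact hasLimits_bosShift (h.one_le (by omega) hk hkt)
        (one_le_rowStart_sub h hd hu hut (by omega) hkt hi)
  swap k hk hku L M := by
    rw [bosChain, bosChain, if_pos hku.le, if_pos (show k + 1 ≤ u from hku),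
      extend_bosFin_swap (bosRange_row h hS hut hd hk hku.le le_rfl), fSeq_of_lt hku,
      h.rec_eq k hk (by omega), hS.rec_eq k hk hku]
    congr 2 <;> push_cast <;> ring
  turn L M := by
    have hr := bosRange_row h hS hut hd hu le_rfl (i := d) (by rw [fSeq_self])
    rw [bosChain, bosChain, if_pos le_rfl, if_neg (show ¬ u + 1 ≤ u by omega), fSeq_self,
      hS.after_end, hS.at_end, mul_one, sub_self,
      extend_bosFin_one_zero hr.one_le_left hr.one_le_right, rowStart, if_pos rfl]
    simp
  swap_shift k hk hkt L M hLM := by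
    rw [bosChain, bosChain, if_neg (show ¬ k ≤ u by omega), if_neg (show ¬ k + 1 ≤ u by omega),
      extend_bosShift (h.one_le (by omega) (by omega) (by omega))
        (one_le_rowStart_sub h hd hu hut hk (by omega) le_rfl) hLM,
      rowStart_sub h hd hu hk hkt, rowStart, if_neg (show ¬ k + 1 = u + 1 by omega),
      Nat.add_sub_cancel]
    simp
  last L M hLM := by
    rw [bosChain, if_neg (by omega), rowStart_sub_last h hd hut, h.after_end,
      extend_bosShift_one_two hLM]

end

end

/-! ### Identification of the weights with the fermionic summands -/

section

variable {t u d : ℕ} {f : ℕ → ℕ} {n : ℕ → ℕ → ℕ} {x : ℕ}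

/-- The Gaussian or reciprocal factor attached to the `j`-th part of the `k`-th partition. -/
def partFactor (u : ℕ) (f : ℕ → ℕ) (n : ℕ → ℕ → ℕ) (k j : ℕ) : ℤ⟦X⟧ :=
  stepFactor (wBound u f n k - ((∑ l ∈ Finset.Ico 1 j, n k l : ℕ) : ℕ∞))
    (part u f n k (j - 1)) (n k j)

theorem prod_partWeight (hux : u ≤ x) :
    ∏ k ∈ Finset.Icc 1 x, ∏ j ∈ Finset.Icc 1 (f k), partWeight u f n k j =
      PowerSeries.X ^ (∑ k ∈ Finset.Icc 1 u, ∑ i ∈ Finset.Icc 1 (f k), n k i ^ 2 +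
        ∑ k ∈ Finset.Icc (u + 1) x, ∑ i ∈ Finset.Icc 1 (f k), n k i * (n k i - 1)) *
      ∏ k ∈ Finset.Icc 1 x, ∏ j ∈ Finset.Icc 1 (f k), partFactor u f n k j := by
  have h1 : ∀ k, ∏ j ∈ Finset.Icc 1 (f k), partWeight u f n k j =
      PowerSeries.X ^ (∑ j ∈ Finset.Icc 1 (f k), partExp u k (n k j)) *
        ∏ j ∈ Finset.Icc 1 (f k), partFactor u f n k j := by
    intro k
    rw [← Finset.prod_pow_eq_pow_sum, ← Finset.prod_mul_distrib]
    rfl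
  simp_rw [h1]
  rw [Finset.prod_mul_distrib, Finset.prod_pow_eq_pow_sum]
  congr 2
  have h2 : Finset.Icc 1 x = Finset.Icc 1 u ∪ Finset.Icc (u + 1) x := by
    ext k
    simp only [Finset.mem_union, Finset.mem_Icc]
    omega
  rw [h2, Finset.sum_union]
  · congr 1 <;> refine Finset.sum_congr rfl fun k hk => Finset.sum_congr rfl fun j _ => ?_ <;>
      rw [Finset.mem_Icc] at hk
    · exact if_pos hk.2
    · exact if_neg (by omega)
  · rw [Finset.disjoint_left]
    intro k hk hk'
    rw [Finset.mem_Icc] at hk hk'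
    omega

theorem prefixWeight_eq (h : IsAdmissible t u f x n) (hu : 1 ≤ u) (hut : u ≤ t) (hfu : 1 ≤ f u)
    (hd : f u = d) :
    prefixWeight u f x (f x) n = PowerSeries.X ^ fermExp u d f x n *
      ∏ k ∈ Finset.Icc 1 x, ∏ j ∈ Finset.Icc 1 (f k), partFactor u f n k j := by
  have hux := h.u_le
  have h1 : (if u < x then (PowerSeries.X : ℤ⟦X⟧) ^ n u (f u) else 1) =
      PowerSeries.X ^ n u d := by
    split_ifs with hlt
    · rw [hd]
    -- For x = u the weight has no turning factor, but then x < t + 1 forces n_{u,d} = 0, so the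
    -- extra power is trivial.
    · obtain rfl : u = x := by omega
      have := h.last_zero (by omega)
      rw [part_of_pos hfu, hd] at this
      rw [Nat.cast_eq_zero.1 this, pow_zero]
  have h2 : Finset.Icc 1 x = insert x (Finset.Ico 1 x) := by
    ext k
    simp only [Finset.mem_insert, Finset.mem_Icc, Finset.mem_Ico]
    omega
  have h3 := prod_partWeight (f := f) (n := n) hux
  nth_rewrite 1 [h2] at h3
  rw [Finset.prod_insert (by simp)] at h3
  rw [prefixWeight, h1, mul_comm (∏ k' ∈ _, _), h3, fermExp, add_assoc,
    pow_add _ (n u d), mul_assoc]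

theorem part_ne_top {k j : ℕ} (h : 1 ≤ j ∨ part u f n k 0 ≠ ⊤) : part u f n k j ≠ ⊤ := by
  rcases Nat.eq_zero_or_pos j with rfl | hj
  · exact h.resolve_left (by omega)
  · rw [part_of_pos hj]
    exact ENat.natCast_ne_top _

theorem bounds_succ_ne_top {k : ℕ} (hk : 1 ≤ k) (hw : wBound u f n k ≠ ⊤)
    (hp : part u f n k (f k) ≠ ⊤) :
    wBound u f n (k + 1) ≠ ⊤ ∧ part u f n (k + 1) 0 ≠ ⊤ := by
  have h1 : ∀ {a b : ℕ∞}, a ≠ ⊤ → a - b ≠ ⊤ := fun ha =>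
    (tsub_le_self.trans_lt (lt_top_iff_ne_top.2 ha)).ne
  have h2 : ∀ {a : ℕ∞}, a ≠ ⊤ → a + 1 ≠ ⊤ := fun ha => by simp [ha]
  rw [wBound, part_zero, bounds_succ hk]
  split_ifs
  · exact ⟨hp, h1 hw⟩
  · exact ⟨h1 (h1 hw), h2 hp⟩
  · exact ⟨h1 hp, h1 (h2 hw)⟩

theorem bounds_ne_top {m : ℕ} (hm : 1 ≤ m) (hw : wBound u f n m ≠ ⊤) (hf : 1 ≤ f m) {k : ℕ}
    (hk : m < k) : wBound u f n k ≠ ⊤ ∧ part u f n k 0 ≠ ⊤ := by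
  induction k, (show m + 1 ≤ k from hk) using Nat.le_induction with
  | base => exact bounds_succ_ne_top hm hw (part_ne_top (Or.inl hf))
  | succ k hk ih =>
    have := ih (by omega)
    exact bounds_succ_ne_top (by omega) this.1 (part_ne_top (Or.inr this.2))

/-- The step factor uses the weight remaining before the j-th part and the stated Gaussian the
weight after it; the difference 2n_{k,j} changes n_{k,j-1} - n_{k,j} into n_{k,j-1} + n_{k,j}. -/
theorem partFactor_eq_fermGauss {k j : ℕ} (hwt : (wt f n k : ℕ∞) ≤ wBound u f n k)
    (hw : wBound u f n k ≠ ⊤) (hj : 1 ≤ j) (hjf : j ≤ f k) (hp : part u f n k (j - 1) ≠ ⊤) :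
    partFactor u f n k j = fermGauss u f n k j := by
  unfold partFactor fermGauss
  obtain ⟨w, hw'⟩ := ENat.ne_top_iff_exists.1 hw
  obtain ⟨a, ha⟩ := ENat.ne_top_iff_exists.1 hp
  rw [← hw'] at hwt ⊢
  rw [← ha]
  have hle : ∑ l ∈ Finset.Ico 1 j, n k l ≤ w := by
    refine le_trans ?_ (Nat.cast_le.1 hwt)
    refine Finset.sum_le_sum_of_subset fun l hl => ?_
    rw [Finset.mem_Ico] at hl
    rw [Finset.mem_Icc]
    omega
  have hsum : ∑ l ∈ Finset.Icc 1 j, (n k l : ℤ) =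
      (∑ l ∈ Finset.Ico 1 j, n k l : ℕ) + (n k j : ℤ) := by
    obtain ⟨j, rfl⟩ := Nat.exists_eq_add_of_le' hj
    rw [Finset.sum_Icc_succ_top (by omega)]
    push_cast
    congr 1
  rw [← ENat.natCast_sub, stepFactor, if_neg (ENat.natCast_ne_top _),
    if_neg (ENat.natCast_ne_top _), ENat.toNat_natCast, ENat.toNat_natCast, ENat.toNat_natCast,
    gauss_eq_gaussZ, hsum, Nat.cast_sub hle]
  congr 1
  ring

theorem partFactor_eq_fermRecip {k j : ℕ} (hw : wBound u f n k = ⊤)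
    (hp : part u f n k (j - 1) ≠ ⊤) : partFactor u f n k j = fermRecip u f n k j := by
  simp [partFactor, fermRecip, stepFactor, hw, hp]

theorem partFactor_one {k : ℕ} (hw : wBound u f n k ≠ ⊤) (hp : part u f n k 0 = ⊤) :
    partFactor u f n k 1 = recip (qPoch (2 * (wBound u f n k).toNat)) := by
  simp [partFactor, stepFactor, hw, hp]

/-- The factors from the first row with finite weight bound onwards. -/
theorem prod_partFactor (h : IsAdmissible t u f x n) {m : ℕ} (hm : 1 ≤ m) (hmx : m ≤ x)
    (hw : wBound u f n m ≠ ⊤) (hp : part u f n m 0 = ⊤)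
    (hf : 1 ≤ f m ∨ (x = m ∧ f m = 0)) :
    ∏ k ∈ Finset.Icc m x, ∏ j ∈ Finset.Icc 1 (f k), partFactor u f n k j =
      recip (qPoch (2 * (wBound u f n m).toNat)) *
        ∏ k ∈ Finset.Icc m x, ∏ j ∈ Finset.Icc (1 + if k = m then 1 else 0) (f k),
          fermGauss u f n k j := by
  have hins : Finset.Icc m x = insert m (Finset.Icc (m + 1) x) := by
    ext k
    simp only [Finset.mem_insert, Finset.mem_Icc]
    omega
  rw [hins, Finset.prod_insert (by simp), Finset.prod_insert (by simp), if_pos rfl, ← mul_assoc]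
  congr 1
  · rcases hf with hf | ⟨rfl, hf⟩
    · have h1 : Finset.Icc 1 (f m) = insert 1 (Finset.Icc (1 + 1) (f m)) := by
        ext j
        simp only [Finset.mem_insert, Finset.mem_Icc]
        omega
      rw [h1, Finset.prod_insert (by simp), partFactor_one hw hp]
      congr 1
      refine Finset.prod_congr rfl fun j hj => ?_
      rw [Finset.mem_Icc] at hj
      exact partFactor_eq_fermGauss (h.wt_le m hm hmx) hw (by omega) hj.2
        (part_ne_top (Or.inl (by omega)))
    -- An empty final row provides no first factor, but its weight bound is then 0 and the
    -- reciprocal is 1.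
    · have h0 := h.wt_last
      rw [wt, hf] at h0
      simp only [Nat.lt_one_iff, pos_of_gt, Finset.Icc_eq_empty_of_lt, Finset.sum_empty,
        Nat.cast_zero] at h0
      rw [hf, ← h0]
      simp [recip_qPoch_zero]
  · refine Finset.prod_congr rfl fun k hk => ?_
    rw [Finset.mem_Icc] at hk
    rw [if_neg (by omega), add_zero]
    have hf' : 1 ≤ f m := hf.resolve_right fun h => by omega
    have hb := bounds_ne_top hm hw hf' (show m < k by omega)
    refine Finset.prod_congr rfl fun j hj => ?_
    rw [Finset.mem_Icc] at hj
    exact partFactor_eq_fermGauss (h.wt_le k (by omega) hk.2) hb.1 hj.1 hj.2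
      (part_ne_top (Or.inr hb.2))

theorem wBound_one : wBound u f n 1 = ⊤ := rfl

theorem part_one_zero : part u f n 1 0 = ⊤ := by simp [part, bounds]

theorem prod_partFactor_one (hf : 1 ≤ f 1) :
    ∏ j ∈ Finset.Icc 1 (f 1), partFactor u f n 1 j =
      ∏ j ∈ Finset.Icc 2 (f 1), fermRecip u f n 1 j := by
  have h1 : Finset.Icc 1 (f 1) = insert 1 (Finset.Icc 2 (f 1)) := by
    ext j
    simp only [Finset.mem_insert, Finset.mem_Icc]
    omega
  rw [h1, Finset.prod_insert (by simp)]
  have h2 : partFactor u f n 1 1 = 1 := by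
    simp [partFactor, stepFactor, wBound_one, part_one_zero]
  rw [h2, one_mul]
  refine Finset.prod_congr rfl fun j hj => ?_
  rw [Finset.mem_Icc] at hj
  exact partFactor_eq_fermRecip wBound_one (part_ne_top (Or.inl (by omega)))

theorem prefixWeight_eq_fermTermGt (h : IsAdmissible t u f x n) (hu : 1 < u) (hut : u ≤ t)
    (hfu : 1 ≤ f u) (hd : f u = d) (hf1 : 1 ≤ f 1) (hf2 : 1 ≤ f 2) :
    prefixWeight u f x (f x) n = fermTermGt u d f x n := by
  have hux := h.u_le
  have hw2 : wBound u f n 2 = (n 1 (f 1) : ℕ∞) := by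
    rw [wBound, bounds_succ le_rfl, if_pos hu]
    exact part_of_pos hf1
  have hp2 : part u f n 2 0 = ⊤ := by
    rw [part_zero, bounds_succ le_rfl, if_pos hu]
    simp [wBound_one]
  have hins : Finset.Icc 1 x = insert 1 (Finset.Icc 2 x) := by
    ext k
    simp only [Finset.mem_insert, Finset.mem_Icc]
    omega
  rw [prefixWeight_eq h hu.le hut hfu hd, hins, Finset.prod_insert (by simp),
    prod_partFactor_one hf1, prod_partFactor h one_le_two (by omega)
      (by rw [hw2]; exact ENat.natCast_ne_top _) hp2 (Or.inl hf2), hw2, ENat.toNat_natCast,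
    fermTermGt]
  ring

theorem prefixWeight_eq_fermTermOne (h : IsAdmissible t 1 f x n) (ht : 1 ≤ t) (hd : f 1 = d)
    (hf1 : 1 ≤ f 1) (hf3 : 3 ≤ t → 1 ≤ f 3) :
    prefixWeight 1 f x (f x) n = fermTermOne d f x n := by
  have hw2 : wBound 1 f n 2 = ⊤ := by
    rw [wBound, bounds_succ le_rfl, if_neg (lt_irrefl 1), if_pos rfl]
    simp [wBound_one]
  have hp2 : part 1 f n 2 0 ≠ ⊤ := by
    rw [part_zero, bounds_succ le_rfl, if_neg (lt_irrefl 1), if_pos rfl, part_of_pos hf1]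
    simp
  have hx : 3 ≤ x := by
    -- For u = 1 the bounds w_1 and w_2 are infinite, so no partition in rows 1 or 2 can attain its
    -- weight bound.
    by_contra hx
    have hlast := h.wt_last
    have := h.u_le
    obtain rfl | rfl : x = 1 ∨ x = 2 := by omega
    · rw [wBound_one] at hlast
      exact ENat.natCast_ne_top _ hlast
    · rw [hw2] at hlast
      exact ENat.natCast_ne_top _ hlast
  have hxt := h.le_t
  have hw3 : wBound 1 f n 3 = part 1 f n 2 (f 2) - 1 := by
    rw [wBound, bounds_succ one_le_two, if_neg (by omega), if_neg (by omega)]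
  have hp3 : part 1 f n 3 0 = ⊤ := by
    rw [part_zero, bounds_succ one_le_two, if_neg (by omega), if_neg (by omega), hw2]
    simp
  have hpf : part 1 f n 2 (f 2) ≠ ⊤ := part_ne_top (Or.inr hp2)
  have hw3' : wBound 1 f n 3 ≠ ⊤ := by
    rw [hw3]
    exact (tsub_le_self.trans_lt (lt_top_iff_ne_top.2 hpf)).ne
  have hins : Finset.Icc 1 x = insert 1 (insert 2 (Finset.Icc 3 x)) := by
    ext k
    simp only [Finset.mem_insert, Finset.mem_Icc]
    omega
  have hrow2 : ∏ j ∈ Finset.Icc 1 (f 2), partFactor 1 f n 2 j =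
      ∏ j ∈ Finset.Icc 1 (f 2), fermRecip 1 f n 2 j :=
    Finset.prod_congr rfl fun j _ =>
      partFactor_eq_fermRecip hw2 (part_ne_top (Or.inr hp2))
  have hf3' : 1 ≤ f 3 ∨ (x = 3 ∧ f 3 = 0) := by
    rcases le_or_gt 3 t with h3 | h3
    · exact Or.inl (hf3 h3)
    · omega
  rw [prefixWeight_eq h le_rfl ht hf1 hd, hins, Finset.prod_insert (by simp),
    Finset.prod_insert (by simp), prod_partFactor_one hf1, hrow2,
    prod_partFactor h (by omega) hx hw3' hp3 hf3', hw3, fermTermOne]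
  have : (part 1 f n 2 (f 2) - 1).toNat = (part 1 f n 2 (f 2)).toNat - 1 := by
    obtain ⟨a, ha⟩ := ENat.ne_top_iff_exists.1 hpf
    rw [← ha]
    exact_mod_cast ENat.toNat_natCast (a - 1)
  rw [this]
  ring

end

end BurgeTree

end

/-! ### Assembly of the identities -/

theorem mainTheorem6 (p p' : ℕ) (hp : 0 < p) (hpp' : p < p') (hcop : Nat.Coprime p p')
    (t : ℕ) (ht : 1 ≤ t) (c : ℕ → ℕ)
    (hc : BurgeTree.IsContFrac ((List.range' 1 (t - 1)).map c ++ [c t + 2]) p' p)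
    (u d : ℕ) (hu : 1 ≤ u) (hut : u ≤ t) (hd : 1 ≤ d) (hdc : d ≤ c u)
    (r s : ℕ)
    (hrs : BurgeTree.IsContFrac ((List.range' 1 (u - 1)).map c ++ [d]) s r) :
    (∀ k : ℤ, 0 ≤ BurgeTree.bosExp₁ p p' r s k ∧ 0 ≤ BurgeTree.bosExp₂ p p' r s k) ∧
    Summable (BurgeTree.bosTerm p p' r s) ∧
    (1 < u →
      HasSum
        (fun σ : BurgeTree.AdmissibleSeq t u (BurgeTree.fSeq c u d) =>
          BurgeTree.fermTermGt u d (BurgeTree.fSeq c u d) σ.1.1 σ.1.2)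
        (BurgeTree.recip BurgeTree.qPochInf * ∑' k : ℤ, BurgeTree.bosTerm p p' r s k)) ∧
    (u = 1 →
      HasSum
        (fun σ : BurgeTree.AdmissibleSeq t u (BurgeTree.fSeq c u d) =>
          BurgeTree.fermTermOne d (BurgeTree.fSeq c u d) σ.1.1 σ.1.2)
        (BurgeTree.recip BurgeTree.qPochInf * ∑' k : ℤ, BurgeTree.bosTerm p p' r s k)) := by
  obtain ⟨P, hP, hP1, hP2⟩ := BurgeTree.exists_isRemainderSeq c ht (c t + 2)
  obtain ⟨S, hS, hS1, hS2⟩ := BurgeTree.exists_isRemainderSeq c hu d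
  rw [hc.cfVal_eq] at hP1 hP2
  rw [hrs.cfVal_eq] at hS1 hS2
  have hc1 : ∀ k, 1 ≤ k → k < t → 1 ≤ c k := fun k h1 h2 => hc.coeff_pos hpp' h1 h2
  have hrange : BurgeTree.BosRange p p' r s := by
    have := BurgeTree.bosRange_row hP hS hut hdc le_rfl hu (i := 0) (Nat.zero_le _)
    rwa [Nat.cast_zero, zero_mul, zero_mul, sub_zero, sub_zero, hP1, hP2, hS1, hS2] at this
  have hterm : BurgeTree.bosTerm p p' r s = fun k => BurgeTree.qpow (BurgeTree.bosExpPos p p' r s k) * 1 -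
      BurgeTree.qpow (BurgeTree.bosExpNeg p p' r s k) * 1 := by
    funext k
    rw [mul_one, mul_one]
    rfl
  have hfu : 1 ≤ BurgeTree.fSeq c u d u := by rwa [BurgeTree.fSeq_self]
  have hf1 : 1 ≤ BurgeTree.fSeq c u d 1 := by
    rcases eq_or_lt_of_le hu with rfl | hu'
    · exact hfu
    · rw [BurgeTree.fSeq_of_lt hu']
      exact hc1 1 le_rfl (by omega)
  -- At the root the diagonal limit is B/(q)_∞², and the factor (q)_∞ in `extend` leaves B/(q)_∞.
  have hroot : BurgeTree.extend (BurgeTree.bosChain P S u d 1 0) ⊤ ⊤ =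
      BurgeTree.recip BurgeTree.qPochInf * ∑' k : ℤ, BurgeTree.bosTerm p p' r s k := by
    rw [hterm, BurgeTree.bosChain, if_pos hu, hP1, hP2, hS1, hS2, Nat.cast_zero, zero_mul, zero_mul,
      sub_zero, sub_zero, BurgeTree.extend_bosFin_top_top hrange]
    rfl
  have hsum := (BurgeTree.isBurgeChain_bosChain hP hS hu hut hdc).hasSum hu hut hf1 hfu
  rw [hroot] at hsum
  refine ⟨fun k => ⟨BurgeTree.bosExpPos_nonneg hrange k, BurgeTree.bosExpNeg_nonneg hrange k⟩, ?_, fun hu' => ?_, ?_⟩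
  · rw [hterm]
    exact (BurgeTree.summable_pos hrange _).sub (BurgeTree.summable_neg hrange _)
  · have hf2 : 1 ≤ BurgeTree.fSeq c u d 2 := by
      rcases eq_or_lt_of_le (show 2 ≤ u from hu') with rfl | hu2
      · exact hfu
      · rw [BurgeTree.fSeq_of_lt hu2]
        exact hc1 2 one_le_two (by omega)
    refine hsum.congr_fun fun σ => ?_
    exact (BurgeTree.prefixWeight_eq_fermTermGt σ.2 hu' hut hfu BurgeTree.fSeq_self hf1 hf2).symm
  · rintro rfl
    refine hsum.congr_fun fun σ => ?_
    refine (BurgeTree.prefixWeight_eq_fermTermOne σ.2 ht BurgeTree.fSeq_self hf1 fun h3 => ?_).symm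
    -- Here f_3 = c_2, positive because 2 < t; for t = 2 it may vanish, a case
    -- `prefixWeight_eq_fermTermOne` allows.
    rw [BurgeTree.fSeq_of_gt (by omega)]
    exact hc1 2 one_le_two (by omega)
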